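/- Let $P$ be a finite graded poset of rank $n$ with $\hat 0$ and $\hat 1$, with rank function $\mathrm{rk}$, and suppose that $P$ is bowtie-free, i.e. there are no distinct elements $a,b,c,d\in P$ such that $a$ and $b$ each cover both $c$ and $d$. Then $P$ has an $S_n$ EL-labeling if and only if $P$ has a good $\mathcal H_n(0)$ action. Here an $S_n$ EL-labeling is a map $\lambda$ from the set of pairs $(s,t)$ with $t$ covering $s$ to $\mathbb Z$ such that (i) every interval $[s,t]$ has exactly one maximal chain with weakly increasing label sequence, (ii) the label sequence of any other maximal chain of $[s,t]$ is lexicographically larger than that of the increasing one, and (iii) for each maximal chain $\hat 0=x_0<x_1<\cdots<x_n=\hat 1$ of $P$ the map $i\mapsto\lambda(x_{i-1},x_i)$ is a permutation of $[n]=\{1,\dots,n\}$. Let $\mathcal M(P)$ be the set of maximal chains of $P$. A local $\mathcal H_n(0)$ action consists of functions $U_1,\dots,U_{n-1}:\mathcal M(P)\to\mathcal M(P)$ such that $U_i(\mathfrak m)$ agrees with $\mathfrak m$ except possibly at rank $i$, $U_i^2=U_i$, $U_iU_j=U_jU_i$ if $|i-j|\ge 2$, and $U_iU_{i+1}U_i=U_{i+1}U_iU_{i+1}$.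 Setting $T_i=-U_i$ makes $\mathbb C\mathcal M(P)$ a representation of the $0$-Hecke algebra $\mathcal H_n(0)$ (the $\mathbb C$-algebra generated by $T_1,\dots,T_{n-1}$ with relations $T_i^2=-T_i$, $T_iT_j=T_jT_i$ for $|i-j|\ge2$, $T_iT_{i+1}T_i=T_{i+1}T_iT_{i+1}$); let $\chi_P$ be its character. The action is good if $$\omega F_P=\mathrm{ch}(\chi_P),$$ where $$F_P=\sum_{\hat 0=t_0\le t_1\le\cdots\le t_{k-1}<t_k=\hat 1}x_1^{\mathrm{rk}(t_1)-\mathrm{rk}(t_0)}\cdots x_k^{\mathrm{rk}(t_k)-\mathrm{rk}(t_{k-1})},$$ the sum being over all multichains from $\hat 0$ to $\hat 1$ in which $\hat 1$ occurs exactly once; for $S\subseteq[n-1]$, $$L_{S,n}=\sum_{\substack{1\le i_1\le\cdots\le i_n\\ i_j<i_{j+1}\text{ if }j\in S}}x_{i_1}\cdots x_{i_n};$$ $\omega$ is the linear map on quasisymmetric functions of degree $n$ with $\omega(L_{S,n})=L_{[n-1]\setminus S,\,n}$; and $\mathrm{ch}$ is the linear map on characters of $\mathcal H_n(0)$ with $\mathrm{ch}(\chi_S)=L_{S,n}$,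 where $\chi_S$ is the character of the one-dimensional representation with $T_i\mapsto-1$ for $i\in S$ and $T_i\mapsto0$ for $i\notin S$. -/

import Mathlib

namespace GradedPoset

noncomputable section

/-! ### Chains, edge-labelings and `S_n` EL-labelings

Throughout, `P` is a finite graded poset with `⊥ = 0̂` and `⊤ = 1̂`; its rank function is
`grade ℕ`, and its rank is `grade ℕ ⊤`. -/

/-- A poset is bowtie-free if there are no distinct `a, b, c, d` such that `a` and `b` both cover
both `c` and `d` (the remaining inequalities between the four elements are automatic). -/
def BowtieFree (P : Type*) [PartialOrder P] : Prop :=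
  ¬ ∃ a b c d : P, a ≠ b ∧ c ≠ d ∧ c ⋖ a ∧ d ⋖ a ∧ c ⋖ b ∧ d ⋖ b

/-- A maximal chain `s = x₀ ⋖ x₁ ⋖ ⋯ ⋖ x_k = t` of length `k` of the interval `[s, t]`. -/
@[ext]
structure SatChain {P : Type*} [PartialOrder P] (s t : P) (k : ℕ) where
  elem : Fin (k + 1) → P
  elem_zero : elem 0 = s
  elem_last : elem (Fin.last k) = t
  covBy : ∀ i : Fin k, elem i.castSucc ⋖ elem i.succ

/-- The maximal chains `0̂ = x₀ ⋖ x₁ ⋖ ⋯ ⋖ x_n = 1̂` of a poset of rank `n`. -/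
abbrev MaxChain (P : Type*) [PartialOrder P] [BoundedOrder P] (n : ℕ) : Type _ :=
  SatChain (⊥ : P) ⊤ n

/-- The edges of the Hasse diagram: pairs `(s, t)` such that `t` covers `s`. -/
abbrev Edge (P : Type*) [PartialOrder P] : Type _ := {e : P × P // e.1 ⋖ e.2}

/-- The sequence of labels `(λ(x₀, x₁), …, λ(x_{k-1}, x_k))` of a chain. -/
def SatChain.labels {P : Type*} [PartialOrder P] {s t : P} {k : ℕ}
    (m : SatChain s t k) (lab : Edge P → ℤ) : Fin k → ℤ :=
  fun i => lab ⟨(m.elem i.castSucc, m.elem i.succ), m.covBy i⟩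

/-- EL-labelings: every interval `[s, t]` has exactly one increasing (i.e. weakly increasing)
maximal chain, and its labels lexicographically precede those of every other maximal chain of
`[s, t]`. All maximal chains of `[s, t]` have length `rk t - rk s`. -/
def IsELLabeling {P : Type*} [PartialOrder P] [GradeOrder ℕ P] (lab : Edge P → ℤ) : Prop :=
  ∀ s t : P, s ≤ t → ∃ m : SatChain s t (grade ℕ t - grade ℕ s),
    Monotone (m.labels lab) ∧
    ∀ m' : SatChain s t (grade ℕ t - grade ℕ s), m' ≠ m →
      ¬ Monotone (m'.labels lab) ∧ toLex (m.labels lab) < toLex (m'.labels lab)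

/-- `S_n` EL-labelings: the labels along each maximal chain form a permutation of `1, …, n`. -/
def IsSnELLabeling {P : Type*} [PartialOrder P] [BoundedOrder P] [GradeOrder ℕ P] (n : ℕ)
    (lab : Edge P → ℤ) : Prop :=
  IsELLabeling lab ∧
    ∀ m : MaxChain P n, ∃ σ : Equiv.Perm (Fin n), ∀ i, m.labels lab i = ((σ i : ℕ) : ℤ) + 1

/-- `P` is `S_n` EL-shellable. -/
def IsSnELShellable (P : Type*) [PartialOrder P] [BoundedOrder P] [GradeOrder ℕ P] (n : ℕ) :
    Prop :=
  ∃ lab : Edge P → ℤ, IsSnELLabeling n lab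

/-! ### Quasisymmetric functions

Formal power series in `x₁, x₂, …`; the variable `x_{i+1}` has index `i : ℕ`. Likewise the set
`[n-1] = {1, …, n-1}` is modelled by `Fin (n - 1)`, where `i : Fin (n - 1)` stands for `i + 1`. -/

/-- The formal power series `∑_a x^{wt a}`, for a family of monomials `x^{wt a}` in which
each monomial occurs finitely often. -/
def monomialSum {A : Type*} (wt : A → (ℕ →₀ ℕ)) : MvPowerSeries ℕ ℂ :=
  fun d => (Nat.card {a : A // wt a = d} : ℂ)

/-- The sequences `i₁ ≤ i₂ ≤ ⋯ ≤ i_n` with `i_j < i_{j+1}` whenever `j ∈ S`. -/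
abbrev FundSeq (n : ℕ) (S : Finset (Fin (n - 1))) : Type :=
  {f : Fin n → ℕ // Monotone f ∧ ∀ j ∈ S, f ⟨j, by omega⟩ < f ⟨j + 1, by omega⟩}

/-- Gessel's fundamental quasisymmetric function `L_{S,n}`, the sum of the monomials
`x_{i₁} x_{i₂} ⋯ x_{i_n}` over the sequences in `FundSeq n S`. -/
def fundamental (n : ℕ) (S : Finset (Fin (n - 1))) : MvPowerSeries ℕ ℂ :=
  monomialSum fun f : FundSeq n S => ∑ j, Finsupp.single (f.1 j) 1

/-- The multichains `0̂ = t₀ ≤ t₁ ≤ ⋯ ≤ t_k = 1̂` in which `1̂` occurs exactly once. -/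
abbrev Multichain (P : Type*) [PartialOrder P] [BoundedOrder P] : Type _ :=
  Σ k : ℕ, {t : Fin (k + 1) → P // Monotone t ∧ t 0 = ⊥ ∧ ∀ j, t j = ⊤ ↔ j = Fin.last k}

/-- Ehrenborg's series `F_P`, the sum over all multichains in `Multichain P` of the monomials
`x₁^{rk(t₀,t₁)} x₂^{rk(t₁,t₂)} ⋯ x_k^{rk(t_{k-1},t_k)}`. -/
def ehrenborg (P : Type*) [PartialOrder P] [BoundedOrder P] [GradeOrder ℕ P] :
    MvPowerSeries ℕ ℂ :=
  monomialSum fun c : Multichain P =>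
    ∑ j : Fin c.1, Finsupp.single (j : ℕ) (grade ℕ (c.2.1 j.succ) - grade ℕ (c.2.1 j.castSucc))

/-- The sequence whose `j`-th entry is the number of elements of `S` before `j`. -/
def canonSeq (n : ℕ) (S : Finset (Fin (n - 1))) (j : Fin n) : ℕ :=
  (S.filter fun i : Fin (n - 1) => (i : ℕ) < (j : ℕ)).card

theorem canonSeq_mono (n : ℕ) (S : Finset (Fin (n - 1))) : Monotone (canonSeq n S) := by
  intro a b hab
  apply Finset.card_le_card
  intro i hi
  simp only [Finset.mem_filter] at hi ⊢
  exact ⟨hi.1, lt_of_lt_of_le hi.2 hab⟩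

theorem canonSeq_lt (n : ℕ) (S : Finset (Fin (n - 1))) (j : Fin (n - 1)) :
    canonSeq n S ⟨j, by omega⟩ < canonSeq n S ⟨j + 1, by omega⟩ ↔ j ∈ S := by
  constructor
  · intro h
    by_contra hj
    refine absurd h (not_lt.2 (Finset.card_le_card ?_))
    intro i hi
    simp only [Finset.mem_filter] at hi ⊢
    refine ⟨hi.1, ?_⟩
    have : i ≠ j := by rintro rfl; exact hj hi.1
    have : (i : ℕ) ≠ j := fun h => this (Fin.ext h)
    omega
  · intro hj
    apply Finset.card_lt_card
    rw [Finset.ssubset_iff_of_subset]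
    · exact ⟨j, by simp [hj], by simp⟩
    · intro i hi
      simp only [Finset.mem_filter] at hi ⊢
      exact ⟨hi.1, by omega⟩

/-- A weakly increasing sequence is determined by its monomial. -/
theorem monotone_eq_of_weight_eq {n : ℕ} {f g : Fin n → ℕ} (hf : Monotone f) (hg : Monotone g)
    (h : ∑ j, Finsupp.single (f j) 1 = ∑ j, Finsupp.single (g j) (1 : ℕ)) : f = g := by
  have key : ∀ f : Fin n → ℕ, ∀ a, (List.ofFn f).count a =
      (∑ j, Finsupp.single (f j) (1 : ℕ)) a := by
    intro f a
    rw [Finsupp.finsetSum_apply]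
    have h1 : ((List.ofFn f : List ℕ) : Multiset ℕ) = Finset.univ.val.map f := by
      rw [Fin.univ_val_map]
    have h2 := congrArg (Multiset.count a) h1
    rw [Multiset.coe_count] at h2
    rw [h2, Multiset.count_map, ← Finset.filter_val, Finset.card_val, Finset.card_filter]
    refine Finset.sum_congr rfl fun j _ => ?_
    rw [Finsupp.single_apply]
    simp only [eq_comm]
  have hp : (List.ofFn f).Perm (List.ofFn g) := by
    rw [List.perm_iff_count]
    intro a
    rw [key, key, h]
  have := hp.eq_of_pairwise' (r := (· ≤ ·)) (List.sortedLE_ofFn_iff.2 hf).pairwise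
    (List.sortedLE_ofFn_iff.2 hg).pairwise
  exact List.ofFn_injective this

theorem coeff_fundamental (n : ℕ) (S T : Finset (Fin (n - 1))) :
    fundamental n T (∑ j, Finsupp.single (canonSeq n S j) 1) = if T ⊆ S then 1 else 0 := by
  unfold fundamental monomialSum
  split_ifs with h
  · have : Nat.card {a : FundSeq n T // ∑ j, Finsupp.single (a.1 j) 1 =
        ∑ j, Finsupp.single (canonSeq n S j) (1 : ℕ)} = 1 := by
      rw [Nat.card_eq_one_iff_exists]
      refine ⟨⟨⟨canonSeq n S, canonSeq_mono n S, fun j hj =>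
        (canonSeq_lt n S j).2 (h hj)⟩, rfl⟩, ?_⟩
      rintro ⟨⟨f, hf, _⟩, hw⟩
      exact Subtype.ext (Subtype.ext (monotone_eq_of_weight_eq hf (canonSeq_mono n S) hw))
    rw [this, Nat.cast_one]
  · have : IsEmpty {a : FundSeq n T // ∑ j, Finsupp.single (a.1 j) 1 =
        ∑ j, Finsupp.single (canonSeq n S j) (1 : ℕ)} := by
      refine ⟨?_⟩
      rintro ⟨⟨f, hf, hT⟩, hw⟩
      obtain rfl := monotone_eq_of_weight_eq hf (canonSeq_mono n S) hw
      exact h fun j hj => (canonSeq_lt n S j).1 (hT j hj)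
    rw [Nat.card_of_isEmpty, Nat.cast_zero]

theorem fundamental_linearIndependent (n : ℕ) : LinearIndependent ℂ (fundamental n) := by
  rw [Fintype.linearIndependent_iff]
  intro c hc S
  induction S using Finset.strongInduction with
  | H S ih =>
    have h : ∑ T, c T * (if T ⊆ S then (1 : ℂ) else 0) = 0 := by
      have h1 := congrArg
        (MvPowerSeries.coeff (R := ℂ) (∑ j, Finsupp.single (canonSeq n S j) 1)) hc
      rw [map_sum, map_zero] at h1
      refine Eq.trans (Finset.sum_congr rfl fun T _ => ?_) h1
      rw [map_smul, smul_eq_mul, ← coeff_fundamental n S T]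
      rfl
    rw [Finset.sum_eq_single S] at h
    · simpa using h
    · intro T _ hT
      by_cases hTS : T ⊆ S
      · rw [ih T (lt_of_le_of_ne hTS hT), zero_mul]
      · rw [if_neg hTS, mul_zero]
    · simp

/-- The space of quasisymmetric functions of degree `n`, with basis the `L_{S,n}`. -/
abbrev QSym (n : ℕ) : Submodule ℂ (MvPowerSeries ℕ ℂ) :=
  Submodule.span ℂ (Set.range (fundamental n))

/-- The involution `ω` on quasisymmetric functions of degree `n`: the linear map with
`ω(L_{S,n}) = L_{[n-1]-S,n}`. -/
def omega (n : ℕ) : QSym n →ₗ[ℂ] MvPowerSeries ℕ ℂ :=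
  Finsupp.linearCombination ℂ (fun S => fundamental n Sᶜ) ∘ₗ
    (fundamental_linearIndependent n).repr

theorem omega_fundamental (n : ℕ) (S : Finset (Fin (n - 1))) :
    omega n ⟨fundamental n S, Submodule.subset_span ⟨S, rfl⟩⟩ = fundamental n Sᶜ := by
  rw [omega, LinearMap.comp_apply,
    (fundamental_linearIndependent n).repr_eq_single S _ rfl,
    Finsupp.linearCombination_single, one_smul]

/-! ### The 0-Hecke algebra, its irreducible characters, and the characteristic -/

/-- The defining relations of the 0-Hecke algebra: `T_i² = -T_i`, `T_i T_j = T_j T_i` if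
`|i - j| ≥ 2`, and `T_i T_{i+1} T_i = T_{i+1} T_i T_{i+1}`. -/
inductive HeckeRel (n : ℕ) :
    FreeAlgebra ℂ (Fin (n - 1)) → FreeAlgebra ℂ (Fin (n - 1)) → Prop
  | sq (i : Fin (n - 1)) :
      HeckeRel n (FreeAlgebra.ι ℂ i * FreeAlgebra.ι ℂ i) (-FreeAlgebra.ι ℂ i)
  | comm (i j : Fin (n - 1)) (h : (i : ℕ) + 2 ≤ j) :
      HeckeRel n (FreeAlgebra.ι ℂ i * FreeAlgebra.ι ℂ j)
        (FreeAlgebra.ι ℂ j * FreeAlgebra.ι ℂ i)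
  | braid (i j : Fin (n - 1)) (h : (j : ℕ) = i + 1) :
      HeckeRel n (FreeAlgebra.ι ℂ i * FreeAlgebra.ι ℂ j * FreeAlgebra.ι ℂ i)
        (FreeAlgebra.ι ℂ j * FreeAlgebra.ι ℂ i * FreeAlgebra.ι ℂ j)

/-- The 0-Hecke algebra `H_n(0)` of type `A_{n-1}` over `ℂ`. -/
abbrev HeckeZero (n : ℕ) : Type := RingQuot (HeckeRel n)

/-- The generator `T_i` of `H_n(0)`. -/
def HeckeZero.T (n : ℕ) (i : Fin (n - 1)) : HeckeZero n :=
  RingQuot.mkAlgHom ℂ (HeckeRel n) (FreeAlgebra.ι ℂ i)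

/-- The algebra homomorphism out of `H_n(0)` given by images of the `T_i` that satisfy the
defining relations. -/
def HeckeZero.lift {n : ℕ} {A : Type*} [Ring A] [Algebra ℂ A] (t : Fin (n - 1) → A)
    (sq : ∀ i, t i * t i = -t i)
    (comm : ∀ i j : Fin (n - 1), (i : ℕ) + 2 ≤ j → t i * t j = t j * t i)
    (braid : ∀ i j : Fin (n - 1), (j : ℕ) = i + 1 → t i * t j * t i = t j * t i * t j) :
    HeckeZero n →ₐ[ℂ] A :=
  RingQuot.liftAlgHom ℂ ⟨FreeAlgebra.lift ℂ t, by
    intro x y h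
    induction h with
    | sq i => simpa using sq i
    | comm i j h => simpa using comm i j h
    | braid i j h => simpa using braid i j h⟩

@[simp]
theorem HeckeZero.lift_T {n : ℕ} {A : Type*} [Ring A] [Algebra ℂ A] (t : Fin (n - 1) → A)
    (sq : ∀ i, t i * t i = -t i)
    (comm : ∀ i j : Fin (n - 1), (i : ℕ) + 2 ≤ j → t i * t j = t j * t i)
    (braid : ∀ i j : Fin (n - 1), (j : ℕ) = i + 1 → t i * t j * t i = t j * t i * t j)
    (i : Fin (n - 1)) : HeckeZero.lift t sq comm braid (HeckeZero.T n i) = t i := by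
  simp [HeckeZero.lift, HeckeZero.T]

/-- The one-dimensional irreducible representation `ψ_S` of `H_n(0)`: `T_i ↦ -1` for `i ∈ S`
and `T_i ↦ 0` for `i ∉ S`. -/
def irrep (n : ℕ) (S : Finset (Fin (n - 1))) : HeckeZero n →ₐ[ℂ] ℂ :=
  HeckeZero.lift (fun i => if i ∈ S then -1 else 0)
    (fun i => by split_ifs <;> norm_num)
    (fun _ _ _ => mul_comm _ _)
    (fun i j _ => by split_ifs <;> norm_num)

/-- The character `χ_S` of `ψ_S`. -/
def irrChar (n : ℕ) (S : Finset (Fin (n - 1))) : HeckeZero n →ₗ[ℂ] ℂ :=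
  (irrep n S).toLinearMap

theorem irrep_injective (n : ℕ) : Function.Injective (irrep n) := by
  intro S T h
  ext i
  have := DFunLike.congr_fun h (HeckeZero.T n i)
  simp only [irrep, HeckeZero.lift_T] at this
  by_cases h1 : i ∈ S <;> by_cases h2 : i ∈ T <;> simp_all

theorem irrChar_linearIndependent (n : ℕ) : LinearIndependent ℂ (irrChar n) := by
  have h := (linearIndependent_monoidHom (HeckeZero n) ℂ).comp
    (fun S => ((irrep n S : HeckeZero n →* ℂ)))
    (fun S T hST => irrep_injective n (AlgHom.ext fun x => DFunLike.congr_fun hST x))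
  rw [Fintype.linearIndependent_iff] at h ⊢
  intro c hc
  refine h c ?_
  funext x
  have := DFunLike.congr_fun hc x
  simpa [irrChar] using this

/-- The linear span of the irreducible characters of `H_n(0)`; it contains the character of
each finite-dimensional representation. -/
abbrev CharSpace (n : ℕ) : Submodule ℂ (HeckeZero n →ₗ[ℂ] ℂ) :=
  Submodule.span ℂ (Set.range (irrChar n))

/-- The characteristic: the linear map with `ch(χ_S) = L_{S,n}`. -/
def ch (n : ℕ) : CharSpace n →ₗ[ℂ] MvPowerSeries ℕ ℂ :=
  Finsupp.linearCombination ℂ (fundamental n) ∘ₗ (irrChar_linearIndependent n).repr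

theorem ch_irrChar (n : ℕ) (S : Finset (Fin (n - 1))) :
    ch n ⟨irrChar n S, Submodule.subset_span ⟨S, rfl⟩⟩ = fundamental n S := by
  rw [ch, LinearMap.comp_apply,
    (irrChar_linearIndependent n).repr_eq_single S _ rfl,
    Finsupp.linearCombination_single, one_smul]

/-! ### Local and good actions -/

/-- A local `H_n(0)` action on the maximal chains of `P`: functions `U_i`, where `U_i(m)` agrees
with `m` except possibly at rank `i`, with `U_i² = U_i`, `U_i U_j = U_j U_i` for `|i - j| ≥ 2`,
and `U_i U_{i+1} U_i = U_{i+1} U_i U_{i+1}`. (Recall that `i : Fin (n - 1)` stands for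
`i + 1`.) -/
structure LocalHeckeAction (P : Type*) [PartialOrder P] [BoundedOrder P] (n : ℕ) where
  U : Fin (n - 1) → MaxChain P n → MaxChain P n
  isLocal : ∀ (i : Fin (n - 1)) m (j : Fin (n + 1)), (j : ℕ) ≠ i + 1 → (U i m).elem j = m.elem j
  idem : ∀ i m, U i (U i m) = U i m
  comm : ∀ i j : Fin (n - 1), (i : ℕ) + 2 ≤ j → ∀ m, U i (U j m) = U j (U i m)
  braid : ∀ i j : Fin (n - 1), (j : ℕ) = i + 1 → ∀ m, U i (U j (U i m)) = U j (U i (U j m))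

/-- The linear operator `-U_i` on the complex vector space with basis the maximal chains. -/
def LocalHeckeAction.op {P : Type*} [PartialOrder P] [BoundedOrder P] {n : ℕ}
    (A : LocalHeckeAction P n) (i : Fin (n - 1)) : Module.End ℂ (MaxChain P n →₀ ℂ) :=
  -Finsupp.lmapDomain ℂ ℂ (A.U i)

theorem LocalHeckeAction.op_single {P : Type*} [PartialOrder P] [BoundedOrder P] {n : ℕ}
    (A : LocalHeckeAction P n) (i : Fin (n - 1)) (m : MaxChain P n) (c : ℂ) :
    A.op i (Finsupp.single m c) = Finsupp.single (A.U i m) (-c) := by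
  simp [LocalHeckeAction.op, Finsupp.mapDomain_single]

/-- The defining representation of a local `H_n(0)` action on the complex vector space with basis
the maximal chains: `T_i` acts as `-U_i`. -/
def LocalHeckeAction.rep {P : Type*} [PartialOrder P] [BoundedOrder P] {n : ℕ}
    (A : LocalHeckeAction P n) : HeckeZero n →ₐ[ℂ] Module.End ℂ (MaxChain P n →₀ ℂ) :=
  HeckeZero.lift A.op
    (fun i => by
      refine Finsupp.lhom_ext fun m c => ?_
      rw [LinearMap.neg_apply]
      simp only [Module.End.mul_apply, A.op_single, A.idem]
      exact Finsupp.single_neg _ _)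
    (fun i j h => by
      refine Finsupp.lhom_ext fun m c => ?_
      simp only [Module.End.mul_apply, A.op_single, A.comm i j h])
    (fun i j h => by
      refine Finsupp.lhom_ext fun m c => ?_
      simp only [Module.End.mul_apply, A.op_single, A.braid i j h])

/-- The character `χ_P` of the defining representation. -/
def LocalHeckeAction.character {P : Type*} [PartialOrder P] [BoundedOrder P] {n : ℕ}
    (A : LocalHeckeAction P n) : HeckeZero n →ₗ[ℂ] ℂ :=
  LinearMap.trace ℂ (MaxChain P n →₀ ℂ) ∘ₗ A.rep.toLinearMap

/-- A local `H_n(0)` action is good if `ω F_P = ch(χ_P)`. (The two memberships only say that `F_P`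
is in the domain of `ω` and `χ_P` in the domain of `ch`, which is always so.) -/
def LocalHeckeAction.IsGood {P : Type*} [PartialOrder P] [BoundedOrder P] [GradeOrder ℕ P]
    {n : ℕ} (A : LocalHeckeAction P n) : Prop :=
  ∃ (hF : ehrenborg P ∈ QSym n) (hχ : A.character ∈ CharSpace n),
    omega n ⟨ehrenborg P, hF⟩ = ch n ⟨A.character, hχ⟩

/-- `P` has a good `H_n(0)` action. -/
def HasGoodHeckeAction (P : Type*) [PartialOrder P] [BoundedOrder P] [GradeOrder ℕ P] (n : ℕ) :
    Prop :=
  ∃ A : LocalHeckeAction P n, A.IsGood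

end

end GradedPoset

/-!
Call a local action *triangular* if a word in the `U_i` fixes a maximal chain only when each of its
letters does, and say that it *has unique fixed extensions* if, for each set `J` of ranks, every
maximal chain can be changed in exactly one way at the ranks in `J` so as to be fixed by all `U_j`
with `j ∈ J`. The proof passes through these two properties in both directions.

Let `D(m)` be the set of `i` with `U_i m ≠ m`. Triangularity gives `χ_P = ∑_m χ_{[n-1] - D(m)}`, as
the trace of a word is, up to sign, the number of its fixed chains (`character_eq_sum`). The
multichains that contribute a given monomial to `F_P` correspond to the maximal chains modulo
agreement at a certain set of ranks (`exists_multichain_map`); choosing the fixed representative of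
each class gives `F_P = ∑_m L_{D(m), n}` (`HasUniqueFixed.ehrenborg_eq_sum`). So an action with both
properties is good.

Given an `S_n` EL-labeling, let `U_i` replace the part of a chain around rank `i` by the increasing
chain of that interval of rank two. This sorts two labels of the chain. It lowers the label sequence
lexicographically, whence triangularity, and a chain whose labels increase around each rank in `J`
is determined by its elements at the other ranks (`IsSnELLabeling.eq_of_agreeOff`), whence the
braid relations and unique fixed extensions.

Conversely, comparing coefficients in `ω F_P = ch(χ_P)` shows that a word with set of letters `J`
has as many fixed chains as there are chains of `P` on exactly the ranks outside `J`
(`IsGood.card_fixed`). For each `J` some such word absorbs each of its letters on the left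
(`exists_absorbing_word`), and counting its fixed chains yields the two properties. By
triangularity, the nontrivial steps `m ↦ U_i m` have no cycles. Multiplying the simple
transpositions along a path of such steps down to a chain fixed by all `U_i` assigns to `m` a
permutation. Two paths give the same permutation because their first steps can be completed to a
square or a hexagon, and the hexagon is nondegenerate because its degenerations are bowties
(`U_U_U_ne`). The permutation of `m` has descent set `D(m)`, and its value at a step of `m` depends
only on that edge of the Hasse diagram (`IsTriangular.perm_apply_eq`). This labels the edges, and
unique fixed extensions make the labeling an `S_n` EL-labeling.
-/

namespace GradedPoset

/-! ### Chains indexed by natural numbers -/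

namespace SatChain

variable {P : Type*} [PartialOrder P] {s t : P} {k : ℕ}

/-- The element of a chain at position `r`, for an arbitrary natural number `r`; positions past
the end carry the last element. -/
def node (m : SatChain s t k) (r : ℕ) : P :=
  if h : r < k + 1 then m.elem ⟨r, h⟩ else t

theorem elem_eq_node (m : SatChain s t k) (i : Fin (k + 1)) : m.elem i = m.node i := by
  rw [node, dif_pos i.2]

theorem node_zero (m : SatChain s t k) : m.node 0 = s := by
  simpa [node] using m.elem_zero

theorem node_of_ge (m : SatChain s t k) {r : ℕ} (h : k ≤ r) : m.node r = t := by
  unfold node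
  split_ifs with h1
  · obtain rfl : r = k := by omega
    exact m.elem_last
  · rfl

theorem node_covBy (m : SatChain s t k) {r : ℕ} (h : r < k) : m.node r ⋖ m.node (r + 1) := by
  simpa [node, h, h.trans (Nat.lt_succ_self k)] using m.covBy ⟨r, h⟩

theorem ext_node {m m' : SatChain s t k} (h : ∀ r, m.node r = m'.node r) : m = m' := by
  ext i
  rw [elem_eq_node, elem_eq_node, h]

/-- The chain with prescribed elements `f 0 ⋖ f 1 ⋖ ⋯ ⋖ f k`. -/
def ofNode (f : ℕ → P) (h0 : f 0 = s) (hk : f k = t) (hc : ∀ r < k, f r ⋖ f (r + 1)) :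
    SatChain s t k where
  elem i := f i
  elem_zero := h0
  elem_last := hk
  covBy i := hc i i.2

theorem node_ofNode (f : ℕ → P) (h0 : f 0 = s) (hk : f k = t)
    (hc : ∀ r < k, f r ⋖ f (r + 1)) {r : ℕ} (hr : r ≤ k) : (ofNode f h0 hk hc).node r = f r := by
  simp [node, ofNode, Nat.lt_succ_of_le hr]

theorem node_mono (m : SatChain s t k) : Monotone m.node := by
  refine monotone_nat_of_le_succ fun r => ?_
  rcases lt_or_ge r k with h | h
  · exact (m.node_covBy h).le
  · rw [m.node_of_ge h, m.node_of_ge (h.trans (Nat.le_succ r))]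

theorem grade_node [GradeOrder ℕ P] (m : SatChain s t k) {r : ℕ} (hr : r ≤ k) :
    grade ℕ (m.node r) = grade ℕ s + r := by
  induction r with
  | zero => rw [node_zero, Nat.add_zero]
  | succ r ih =>
    have := Order.covBy_iff_add_one_eq.1 ((m.node_covBy (r := r) (by omega)).grade ℕ)
    rw [← this, ih (by omega), Nat.add_assoc]

/-- A chain with the elements strictly between positions `a` and `a + l` replaced by those of
another chain with the same ends. -/
theorem exists_splice (m : SatChain s t k) {x y : P} {a l : ℕ} (c : SatChain x y l)
    (hal : a + l ≤ k) (hx : m.node a = x) (hy : m.node (a + l) = y) :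
    ∃ m' : SatChain s t k, (∀ r, r ≤ a ∨ a + l ≤ r → m'.node r = m.node r) ∧
      ∀ r ≤ l, m'.node (a + r) = c.node r := by
  classical
  let f : ℕ → P := fun r => if a ≤ r ∧ r ≤ a + l then c.node (r - a) else m.node r
  have hf1 : ∀ r, r ≤ a ∨ a + l ≤ r → f r = m.node r := by
    intro r hr
    by_cases h : a ≤ r ∧ r ≤ a + l
    · simp only [f, if_pos h]
      rcases hr with hr | hr
      · obtain rfl : r = a := by omega
        rw [Nat.sub_self, node_zero, hx]
      · obtain rfl : r = a + l := by omega
        rw [c.node_of_ge (by omega), hy]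
    · simp only [f, if_neg h]
  have hf2 : ∀ r ≤ l, f (a + r) = c.node r := by
    intro r hr
    simp only [f]
    rw [if_pos (by omega), Nat.add_sub_cancel_left]
  have hc : ∀ r < k, f r ⋖ f (r + 1) := by
    intro r hr
    by_cases h : a ≤ r ∧ r < a + l
    · obtain ⟨q, rfl⟩ := Nat.exists_eq_add_of_le h.1
      rw [hf2 q (by omega), Nat.add_assoc, hf2 (q + 1) (by omega)]
      exact c.node_covBy (by omega)
    · rw [hf1 r (by omega), hf1 (r + 1) (by omega)]
      exact m.node_covBy hr
  have h0 : f 0 = s := by rw [hf1 0 (by omega), node_zero]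
  have hk : f k = t := by rw [hf1 k (by omega), m.node_of_ge le_rfl]
  refine ⟨ofNode f h0 hk hc, fun r hr => ?_, fun r hr => ?_⟩
  · rcases le_or_gt r k with h | h
    · rw [node_ofNode _ _ _ _ h, hf1 r hr]
    · rw [node_of_ge _ h.le, node_of_ge _ h.le]
  · rw [node_ofNode _ _ _ _ (by omega), hf2 r hr]

/-- The part of a chain between positions `a` and `a + l`. -/
theorem exists_restrict (m : SatChain s t k) {x y : P} {a l : ℕ}
    (hal : a + l ≤ k) (hx : m.node a = x) (hy : m.node (a + l) = y) :
    ∃ c : SatChain x y l, ∀ r ≤ l, c.node r = m.node (a + r) :=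
  ⟨ofNode (fun r => m.node (a + r)) hx hy fun _ hr => m.node_covBy (by omega),
    fun _ hr => node_ofNode _ _ _ _ hr⟩

instance [Finite P] : Finite (SatChain s t k) :=
  Finite.of_injective SatChain.elem fun _ _ h => SatChain.ext h

end SatChain

/-! ### Existence of maximal chains -/

section Extension

variable {P : Type*} [PartialOrder P] [Finite P] [GradeOrder ℕ P]

theorem exists_path {s t : P} (hst : s ≤ t) :
    ∃ g : ℕ → P, g (grade ℕ s) = s ∧ g (grade ℕ t) = t ∧
      ∀ r, grade ℕ s ≤ r → r < grade ℕ t → g r ⋖ g (r + 1) := by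
  induction s using WellFoundedGT.induction with
  | ind s ih =>
    rcases hst.eq_or_lt with rfl | hlt
    · exact ⟨fun _ => s, rfl, rfl, fun r h1 h2 => by omega⟩
    · obtain ⟨x, hsx, hxt⟩ := exists_covBy_le_of_lt hlt
      obtain ⟨g, hg1, hg2, hg3⟩ := ih x hsx.lt hxt
      have hgr := Order.covBy_iff_add_one_eq.1 (hsx.grade ℕ)
      have hgt : grade ℕ s < grade ℕ t := grade_strictMono hlt
      refine ⟨fun r => if r ≤ grade ℕ s then s else g r, by simp, ?_, fun r h1 h2 => ?_⟩
      · simp only [if_neg (not_le.2 hgt), hg2]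
      · rcases h1.eq_or_lt with rfl | h1
        · simp only [le_refl, if_true, if_neg (Nat.not_succ_le_self _)]
          rwa [hgr, hg1]
        · simp only [if_neg (not_le.2 h1), if_neg (not_le.2 (h1.trans (Nat.lt_succ_self r)))]
          exact hg3 r (by omega) h2

theorem exists_path_through {T : ℕ → P} (hT : Monotone T) (k : ℕ) :
    ∃ g : ℕ → P, (∀ j ≤ k, g (grade ℕ (T j)) = T j) ∧
      ∀ r, grade ℕ (T 0) ≤ r → r < grade ℕ (T k) → g r ⋖ g (r + 1) := by
  have hgm : Monotone fun j => grade ℕ (T j) := fun a b h => grade_mono (hT h)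
  induction k with
  | zero =>
    refine ⟨fun _ => T 0, fun j hj => ?_, fun r h1 h2 => by omega⟩
    rw [Nat.le_zero.1 hj]
  | succ k ih =>
    obtain ⟨g, hg1, hg2⟩ := ih
    obtain ⟨p, hp1, hp2, hp3⟩ := exists_path (hT (Nat.le_succ k))
    have hgk : ∀ j ≤ k, grade ℕ (T j) ≤ grade ℕ (T k) := fun j hj => hgm hj
    refine ⟨fun r => if r ≤ grade ℕ (T k) then g r else p r, fun j hj => ?_, fun r h1 h2 => ?_⟩
    · rcases Nat.le_succ_iff.1 hj with hj | rfl
      · simp only [if_pos (hgk j hj), hg1 j hj]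
      · dsimp only
        split_ifs with h
        · have h1 : grade ℕ (T (k + 1)) = grade ℕ (T k) := le_antisymm h (hgm (Nat.le_succ k))
          have h2 : T k = T (k + 1) := by
            by_contra hne
            exact absurd (grade_strictMono (𝕆 := ℕ) ((hT (Nat.le_succ k)).lt_of_ne hne))
              (by omega)
          rw [h1, hg1 k le_rfl, h2]
        · exact hp2
    · rcases lt_trichotomy r (grade ℕ (T k)) with h | rfl | h
      · simp only [if_pos h.le, if_pos (Nat.succ_le_of_lt h)]
        exact hg2 r h1 h
      · simp only [le_refl, if_true, if_neg (Nat.not_succ_le_self _)]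
        rw [hg1 k le_rfl]
        nth_rewrite 1 [← hp1]
        exact hp3 _ le_rfl h2
      · simp only [if_neg (not_le.2 h), if_neg (not_le.2 (h.trans (Nat.lt_succ_self r)))]
        exact hp3 r h.le h2

end Extension

/-! ### Multichains and maximal chains -/

section Words

variable {n : ℕ}

/-- The number of entries of `f` that are less than `j`. -/
def countLT (f : Fin n → ℕ) (j : ℕ) : ℕ := (Finset.univ.filter fun i => f i < j).card

theorem countLT_le (f : Fin n → ℕ) (j : ℕ) : countLT f j ≤ n :=
  (Finset.card_le_univ _).trans (by simp)

theorem countLT_mono (f : Fin n → ℕ) : Monotone (countLT f) := by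
  intro a b h
  refine Finset.card_le_card fun i hi => ?_
  simp only [Finset.mem_filter] at hi ⊢
  exact ⟨hi.1, hi.2.trans_le h⟩

theorem lt_countLT {f : Fin n → ℕ} (hf : Monotone f) (i : Fin n) (j : ℕ) :
    (i : ℕ) < countLT f j ↔ f i < j := by
  constructor
  · intro h
    by_contra hj
    have : countLT f j ≤ (Finset.Iio i).card := by
      refine Finset.card_le_card fun a ha => ?_
      simp only [Finset.mem_filter, Finset.mem_univ, true_and, Finset.mem_Iio] at ha ⊢
      by_contra hia
      exact hj ((hf (not_lt.1 hia)).trans_lt ha)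
    rw [Fin.card_Iio] at this
    omega
  · intro h
    have : (Finset.Iic i).card ≤ countLT f j := by
      refine Finset.card_le_card fun a ha => ?_
      simp only [Finset.mem_filter, Finset.mem_univ, true_and, Finset.mem_Iic] at ha ⊢
      exact (hf ha).trans_lt h
    rw [Fin.card_Iic] at this
    omega

theorem countLT_eq_iff (f : Fin n → ℕ) (j : ℕ) :
    countLT f j = n ↔ Finset.univ.sup (fun i => f i + 1) ≤ j := by
  have h1 : countLT f j = n ↔ ∀ i, f i < j := by
    have := Finset.card_filter_eq_iff (s := (Finset.univ : Finset (Fin n))) (p := fun i => f i < j)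
    rw [Finset.card_univ, Fintype.card_fin] at this
    simpa [countLT] using this
  rw [h1, Finset.sup_le_iff]
  simp

/-- The exponent of the monomial `x_{f 0} x_{f 1} ⋯`. -/
noncomputable def wordWeight (f : Fin n → ℕ) : ℕ →₀ ℕ := ∑ j, Finsupp.single (f j) 1

theorem wordWeight_apply (f : Fin n → ℕ) (a : ℕ) :
    wordWeight f a = countLT f (a + 1) - countLT f a := by
  have h : countLT f (a + 1) = countLT f a + (Finset.univ.filter fun i => f i = a).card := by
    unfold countLT
    rw [← Finset.card_union_of_disjoint]
    · congr 1
      ext i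
      simp only [Finset.mem_filter, Finset.mem_union, Finset.mem_univ, true_and]
      omega
    · rw [Finset.disjoint_filter]
      intro i _ h1 h2
      omega
  rw [h, Nat.add_sub_cancel_left, Finset.card_filter]
  simp [wordWeight, Finsupp.finsetSum_apply, Finsupp.single_apply]

/-- The ranks, less one, at which a multichain of weight `wordWeight f` imposes no condition. -/
def flatSet (f : Fin n → ℕ) : Finset (Fin (n - 1)) :=
  Finset.univ.filter fun j : Fin (n - 1) => ¬ f ⟨j, by omega⟩ < f ⟨j + 1, by omega⟩

end Words

section Agreement

variable {P : Type*} [PartialOrder P] [BoundedOrder P] {n : ℕ}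

/-- Two maximal chains agree at all ranks outside `J`; as everywhere, `j : Fin (n - 1)` stands for
the rank `j + 1`. -/
def AgreeOff (J : Finset (Fin (n - 1))) (m m' : MaxChain P n) : Prop :=
  ∀ r : ℕ, (∀ j ∈ J, r ≠ j + 1) → m.node r = m'.node r

theorem AgreeOff.symm {J : Finset (Fin (n - 1))} {m m' : MaxChain P n} (h : AgreeOff J m m') :
    AgreeOff J m' m := fun r hr => (h r hr).symm

theorem AgreeOff.trans {J : Finset (Fin (n - 1))} {m m' m'' : MaxChain P n}
    (h : AgreeOff J m m') (h' : AgreeOff J m' m'') : AgreeOff J m m'' :=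
  fun r hr => (h r hr).trans (h' r hr)

theorem AgreeOff.mono {J K : Finset (Fin (n - 1))} {m m' : MaxChain P n}
    (h : AgreeOff J m m') (hJK : J ⊆ K) : AgreeOff K m m' :=
  fun r hr => h r fun j hj => hr j (hJK hj)

end Agreement

section Grade

variable {P : Type*} [PartialOrder P] [BoundedOrder P] [GradeMinOrder ℕ P] {n : ℕ}

theorem grade_node_max (m : MaxChain P n) {r : ℕ} (hr : r ≤ n) : grade ℕ (m.node r) = r := by
  rw [m.grade_node hr, grade_bot]
  simp

/-- The exponent of the monomial that a multichain contributes to `ehrenborg P`. -/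
noncomputable def multichainWeight (c : Multichain P) : ℕ →₀ ℕ :=
  ∑ j : Fin c.1, Finsupp.single (j : ℕ) (grade ℕ (c.2.1 j.succ) - grade ℕ (c.2.1 j.castSucc))

theorem multichainWeight_apply (c : Multichain P) (a : ℕ) :
    multichainWeight c a = if h : a < c.1 then
      grade ℕ (c.2.1 ⟨a + 1, by omega⟩) - grade ℕ (c.2.1 ⟨a, by omega⟩) else 0 := by
  unfold multichainWeight
  rw [Finsupp.finsetSum_apply]
  split_ifs with h
  · rw [Finset.sum_eq_single (⟨a, h⟩ : Fin c.1)]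
    · simp
    · intro b _ hb
      rw [Finsupp.single_apply, if_neg]
      exact fun h' => hb (Fin.ext h')
    · simp
  · refine Finset.sum_eq_zero fun b _ => ?_
    rw [Finsupp.single_apply, if_neg]
    have := b.2
    omega

/-- The weights of multichains are those of weakly increasing words of length `n`. -/
theorem exists_wordWeight_eq (hn : grade ℕ (⊤ : P) = n) (c : Multichain P) :
    ∃ f : Fin n → ℕ, Monotone f ∧ wordWeight f = multichainWeight c := by
  obtain ⟨k, t, ht, ht0, htt⟩ := c
  -- The `i`-th letter is the number of steps of the multichain that end at rank at most `i`.
  let f : Fin n → ℕ := fun i =>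
    (Finset.univ.filter fun j : Fin k => grade ℕ (t j.succ) ≤ i).card
  have hf : Monotone f := by
    intro a b hab
    refine Finset.card_le_card fun j hj => ?_
    simp only [Finset.mem_filter, Finset.mem_univ, true_and] at hj ⊢
    exact hj.trans hab
  have htg : ∀ j, grade ℕ (t j) ≤ n := fun j => hn ▸ grade_mono le_top
  have hmono : Monotone fun j => grade ℕ (t j) := fun a b h => grade_mono (ht h)
  have key : ∀ (i : Fin n) (j : ℕ) (hj : j < k + 1), f i < j ↔ (i : ℕ) < grade ℕ (t ⟨j, hj⟩) := by
    intro i j hj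
    rcases j with _ | j
    · have h0 : grade ℕ (t ⟨0, hj⟩) = 0 := (congrArg (grade ℕ) ht0).trans grade_bot
      rw [h0]
      simp
    · constructor
      · intro h
        by_contra hcon
        have : (Finset.Iic (⟨j, by omega⟩ : Fin k)).card ≤ f i := by
          refine Finset.card_le_card fun a ha => ?_
          simp only [Finset.mem_filter, Finset.mem_univ, true_and, Finset.mem_Iic] at ha ⊢
          refine le_trans (hmono (?_ : a.succ ≤ ⟨j + 1, hj⟩)) (not_lt.1 hcon)
          simp only [Fin.le_def, Fin.val_succ] at ha ⊢
          omega
        rw [Fin.card_Iic] at this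
        simp only at this
        omega
      · intro h
        have : f i ≤ (Finset.Iio (⟨j, by omega⟩ : Fin k)).card := by
          refine Finset.card_le_card fun a ha => ?_
          simp only [Finset.mem_filter, Finset.mem_univ, true_and, Finset.mem_Iio] at ha ⊢
          by_contra hcon
          have h2 : grade ℕ (t ⟨j + 1, hj⟩) ≤ grade ℕ (t a.succ) := hmono (by
            simp only [Fin.le_def, Fin.lt_def, Fin.val_succ] at hcon ⊢
            omega)
          omega
        rw [Fin.card_Iio] at this
        simp only at this
        omega
  have hcount : ∀ (j : ℕ) (hj : j < k + 1), countLT f j = grade ℕ (t ⟨j, hj⟩) := by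
    intro j hj
    have h1 : ∀ i : Fin n, (i : ℕ) < countLT f j ↔ (i : ℕ) < grade ℕ (t ⟨j, hj⟩) := fun i =>
      (lt_countLT hf i j).trans (key i j hj)
    have h2 := countLT_le f j
    have h3 := htg ⟨j, hj⟩
    rcases lt_trichotomy (countLT f j) (grade ℕ (t ⟨j, hj⟩)) with h | h | h
    · have := (h1 ⟨_, h.trans_le h3⟩).2 h
      simp only at this
      omega
    · exact h
    · have := (h1 ⟨_, h.trans_le h2⟩).1 h
      simp only at this
      omega
  refine ⟨f, hf, ?_⟩
  ext a
  rw [wordWeight_apply, multichainWeight_apply]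
  split_ifs with h
  · simp only at h ⊢
    rw [hcount (a + 1) (by omega), hcount a (by omega)]
  · simp only at h
    have h1 : t ⟨k, by omega⟩ = ⊤ := (htt _).2 rfl
    have h2 : countLT f k = n := by rw [hcount k (by omega), h1, hn]
    have h3 := countLT_mono f (not_lt.1 h)
    have h4 := countLT_le f (a + 1)
    omega

end Grade

section Multichains

variable {P : Type*} [PartialOrder P] [Finite P] [BoundedOrder P] [GradeMinOrder ℕ P] {n : ℕ}

/-- Every multichain ending in `⊤` extends to a maximal chain. -/
theorem exists_maxChain_through (hn : grade ℕ (⊤ : P) = n) {T : ℕ → P} (hT : Monotone T) {k : ℕ}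
    (h0 : T 0 = ⊥) (hk : T k = ⊤) :
    ∃ m : MaxChain P n, ∀ j ≤ k, m.node (grade ℕ (T j)) = T j := by
  obtain ⟨g, hg1, hg2⟩ := exists_path_through hT k
  have hb : grade ℕ (T 0) = 0 := by rw [h0, grade_bot]; rfl
  have ht : grade ℕ (T k) = n := by rw [hk, hn]
  refine ⟨SatChain.ofNode g ?_ ?_ ?_, fun j hj => ?_⟩
  · rw [← h0, ← hg1 0 (Nat.zero_le k), hb]
  · rw [← hk, ← hg1 k le_rfl, ht]
  · intro r hr
    exact hg2 r (by omega) (by omega)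
  · rw [SatChain.node_ofNode, hg1 j hj]
    rw [← hn]
    exact grade_mono le_top

theorem exists_maxChain_through_pair (hn : grade ℕ (⊤ : P) = n) {s t : P} (hst : s ≤ t) :
    ∃ m : MaxChain P n, m.node (grade ℕ s) = s ∧ m.node (grade ℕ t) = t := by
  let T : ℕ → P := fun j => if j = 0 then ⊥ else if j = 1 then s else if j = 2 then t else ⊤
  have hT : Monotone T := by
    refine monotone_nat_of_le_succ fun j => ?_
    rcases j with _ | _ | _ | j <;> simp [T, hst]
  obtain ⟨m, hm⟩ := exists_maxChain_through hn hT (k := 3) rfl rfl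
  exact ⟨m, hm 1 (by omega), hm 2 (by omega)⟩

/-- For a weakly increasing `f`, the multichains of weight `wordWeight f` correspond to the classes
of maximal chains under agreement outside `flatSet f`: a maximal chain `m` is sent to the multichain
of its elements of ranks `countLT f j`. -/
theorem exists_multichain_map (hn : grade ℕ (⊤ : P) = n) {f : Fin n → ℕ} (hf : Monotone f) :
    ∃ Φ : MaxChain P n → {c : Multichain P // multichainWeight c = wordWeight f},
      Function.Surjective Φ ∧ ∀ m m', Φ m = Φ m' ↔ AgreeOff (flatSet f) m m' := by
  set k := Finset.univ.sup (fun i => f i + 1) with hk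
  have htop : ∀ (m : MaxChain P n) r, r ≤ n → (m.node r = ⊤ ↔ r = n) := by
    intro m r hr
    constructor
    · intro h
      rw [← grade_node_max m hr, h, hn]
    · rintro rfl
      exact m.node_of_ge le_rfl
  let Φ₀ : MaxChain P n → Multichain P := fun m =>
    ⟨k, fun j => m.node (countLT f j), fun a b h => m.node_mono (countLT_mono f h), by
      have : countLT f 0 = 0 := by simp [countLT]
      simp [this, m.node_zero], fun j => by
      rw [htop m _ (countLT_le f j), countLT_eq_iff, Fin.ext_iff, Fin.val_last]
      have := j.2
      omega⟩
  have hΦ₀ : ∀ m, multichainWeight (Φ₀ m) = wordWeight f := by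
    intro m
    ext a
    rw [multichainWeight_apply, wordWeight_apply]
    split_ifs with h
    · simp only [Φ₀]
      rw [grade_node_max m (countLT_le f _), grade_node_max m (countLT_le f _)]
    · have h1 := (countLT_eq_iff f a).2 (not_lt.1 h)
      have h2 := countLT_le f (a + 1)
      omega
  refine ⟨fun m => ⟨Φ₀ m, hΦ₀ m⟩, ?_, fun m m' => ?_⟩
  · rintro ⟨⟨k', t, ht, ht0, htt⟩, hw⟩
    let T : ℕ → P := fun j => if h : j < k' + 1 then t ⟨j, h⟩ else ⊤
    have hTt : ∀ j : Fin (k' + 1), T j = t j := fun j => dif_pos j.2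
    have hT : Monotone T := by
      intro a b hab
      simp only [T]
      split_ifs with h1 h2 h2
      · exact ht hab
      · exact le_top
      · omega
      · exact le_top
    have hTop : ∀ a ≤ k', T a = ⊤ → a = k' := by
      intro a ha h
      have := (htt ⟨a, by omega⟩).1 (by rw [← hTt]; exact h)
      simpa [Fin.ext_iff] using this
    have hgr : ∀ a ≤ k', grade ℕ (T a) = countLT f a := by
      intro a ha
      induction a with
      | zero =>
        have : T 0 = ⊥ := by rw [← ht0, ← hTt]; rfl
        rw [this, grade_bot]
        simp [countLT]
      | succ a ih =>
        have h1 := DFunLike.congr_fun hw a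
        rw [multichainWeight_apply, wordWeight_apply, dif_pos (show a < k' by omega)] at h1
        simp only [← hTt] at h1
        have h2 := countLT_mono f (Nat.le_succ a)
        have h3 : grade ℕ (T a) ≤ grade ℕ (T (a + 1)) := grade_mono (hT (Nat.le_succ a))
        have h4 := ih (by omega)
        simp only [Nat.succ_eq_add_one] at h2
        omega
    have hTk : T k' = ⊤ := by
      rw [← (htt (Fin.last k')).2 rfl, ← hTt]
      rfl
    have hkk : k ≤ k' := by
      rw [hk, ← countLT_eq_iff, ← hgr k' le_rfl, hTk, hn]
    obtain rfl : k = k' := by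
      refine hTop k hkk ?_
      by_contra hne
      have h1 : grade ℕ (T k) < grade ℕ (⊤ : P) := grade_strictMono (lt_top_iff_ne_top.2 hne)
      have h2 := (countLT_eq_iff f k).2 le_rfl
      rw [hgr k hkk] at h1
      omega
    obtain ⟨m, hm⟩ := exists_maxChain_through hn hT (k := k) (by rw [← ht0, ← hTt]; rfl) hTk
    refine ⟨m, Subtype.ext ?_⟩
    simp only [Φ₀, Sigma.mk.injEq, heq_eq_eq, true_and]
    refine Subtype.ext (funext fun j => ?_)
    have h := hm j (by omega)
    rw [hgr j (by omega), hTt] at h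
    exact h
  · have h1 : (⟨Φ₀ m, hΦ₀ m⟩ : {c : Multichain P // multichainWeight c = wordWeight f}) =
        ⟨Φ₀ m', hΦ₀ m'⟩ ↔ ∀ j : Fin (k + 1), m.node (countLT f j) = m'.node (countLT f j) := by
      rw [Subtype.mk.injEq]
      simp only [Φ₀, Sigma.mk.injEq, heq_eq_eq, true_and, Subtype.mk.injEq, funext_iff]
    rw [h1]
    constructor
    · intro h r hr
      rcases Nat.eq_zero_or_pos r with rfl | hr0
      · rw [m.node_zero, m'.node_zero]
      rcases le_or_gt n r with hrn | hrn
      · rw [m.node_of_ge hrn, m'.node_of_ge hrn]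
      -- A rank outside the flat set is the rank of the element indexed by `j = f r`.
      have hlt : f ⟨r - 1, by omega⟩ < f ⟨r, hrn⟩ := by
        by_contra hcon
        refine hr ⟨r - 1, by omega⟩ ?_ (by simp only; omega)
        simp only [flatSet, Finset.mem_filter, Finset.mem_univ, true_and]
        convert hcon using 4
        omega
      have hrk : f ⟨r, hrn⟩ < k := Finset.le_sup (f := fun i => f i + 1) (Finset.mem_univ _)
      have h2 := (lt_countLT hf ⟨r - 1, by omega⟩ (f ⟨r, hrn⟩)).2 hlt
      have h3 := (lt_countLT hf ⟨r, hrn⟩ (f ⟨r, hrn⟩)).not.2 (lt_irrefl _)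
      have h4 := h ⟨f ⟨r, hrn⟩, by omega⟩
      simp only at h2 h3 h4
      have h5 : countLT f (f ⟨r, hrn⟩) = r := by omega
      rwa [h5] at h4
    · intro h j
      rcases Nat.eq_zero_or_pos (countLT f j) with h0 | h0
      · rw [h0, m.node_zero, m'.node_zero]
      refine h _ fun i hi heq => ?_
      simp only [flatSet, Finset.mem_filter, Finset.mem_univ, true_and] at hi
      have h2 := (lt_countLT hf ⟨i, by omega⟩ j).1 (by simp only; omega)
      have h3 := (lt_countLT hf ⟨i + 1, by omega⟩ j).not.1 (by simp only; omega)
      omega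

end Multichains

/-! ### Words in the generators and their characters -/

/-- The word `T_{i₁} T_{i₂} ⋯` in the generators of the 0-Hecke algebra. -/
noncomputable def HeckeZero.word {n : ℕ} (u : List (Fin (n - 1))) : HeckeZero n :=
  (u.map (HeckeZero.T n)).prod

theorem HeckeZero.span_range_word (n : ℕ) :
    Submodule.span ℂ (Set.range (HeckeZero.word (n := n))) = ⊤ := by
  have h1 : Algebra.adjoin ℂ (Set.range (HeckeZero.T n)) = ⊤ := by
    have h := congrArg (Subalgebra.map (RingQuot.mkAlgHom ℂ (HeckeRel n)))
      (FreeAlgebra.adjoin_range_ι ℂ (Fin (n - 1)))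
    rw [AlgHom.map_adjoin, ← Set.range_comp, Algebra.map_top,
      (AlgHom.range_eq_top _).2 (RingQuot.mkAlgHom_surjective ℂ (HeckeRel n))] at h
    exact h
  rw [eq_top_iff, ← Algebra.top_toSubmodule, ← h1, Algebra.adjoin_eq_span]
  refine Submodule.span_mono fun x hx => ?_
  obtain ⟨l, hl, rfl⟩ := Submonoid.exists_list_of_mem_closure hx
  have hl' : l ∈ Set.range (List.map (HeckeZero.T n)) := by
    rw [Set.range_list_map]
    exact hl
  obtain ⟨u, rfl⟩ := hl'
  exact ⟨u, rfl⟩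

theorem irrChar_word {n : ℕ} (S : Finset (Fin (n - 1))) (u : List (Fin (n - 1))) :
    irrChar n S (HeckeZero.word u) = if u.toFinset ⊆ S then (-1) ^ u.length else 0 := by
  change irrep n S (HeckeZero.word u) = _
  induction u with
  | nil => simp [HeckeZero.word]
  | cons i u ih =>
    have h : HeckeZero.word (i :: u) = HeckeZero.T n i * HeckeZero.word u := by
      simp [HeckeZero.word]
    rw [h, map_mul, ih, irrep, HeckeZero.lift_T]
    by_cases h1 : i ∈ S <;> by_cases h2 : u.toFinset ⊆ S <;>
      simp [h1, h2, Finset.insert_subset_iff, pow_succ]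

namespace LocalHeckeAction

section Action

variable {P : Type*} [PartialOrder P] [BoundedOrder P] {n : ℕ}

/-- The composite `U_{i₁} U_{i₂} ⋯` of the maps indexed by the letters of a word. -/
def act (A : LocalHeckeAction P n) (u : List (Fin (n - 1))) (m : MaxChain P n) : MaxChain P n :=
  u.foldr A.U m

@[simp]
theorem act_nil (A : LocalHeckeAction P n) (m : MaxChain P n) : A.act [] m = m := rfl

@[simp]
theorem act_cons (A : LocalHeckeAction P n) (i : Fin (n - 1)) (u : List (Fin (n - 1)))
    (m : MaxChain P n) : A.act (i :: u) m = A.U i (A.act u m) := rfl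

theorem act_append (A : LocalHeckeAction P n) (u v : List (Fin (n - 1))) (m : MaxChain P n) :
    A.act (u ++ v) m = A.act u (A.act v m) := by
  simp [act]

theorem node_U (A : LocalHeckeAction P n) (i : Fin (n - 1)) (m : MaxChain P n) {r : ℕ}
    (hr : r ≠ i + 1) : (A.U i m).node r = m.node r := by
  unfold SatChain.node
  split_ifs with h
  · exact A.isLocal i m ⟨r, h⟩ hr
  · rfl

theorem agreeOff_act (A : LocalHeckeAction P n) {J : Finset (Fin (n - 1))}
    {u : List (Fin (n - 1))} (hu : ∀ i ∈ u, i ∈ J) (m : MaxChain P n) :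
    AgreeOff J (A.act u m) m := by
  intro r hr
  induction u with
  | nil => rfl
  | cons i u ih =>
    rw [act_cons, A.node_U i _ (hr i (hu i (by simp))), ih fun j hj => hu j (by simp [hj])]

theorem act_eq_self (A : LocalHeckeAction P n) {u : List (Fin (n - 1))} {m : MaxChain P n}
    (h : ∀ i ∈ u, A.U i m = m) : A.act u m = m := by
  induction u with
  | nil => rfl
  | cons i u ih => rw [act_cons, ih fun j hj => h j (by simp [hj]), h i (by simp)]

theorem rep_word_single (A : LocalHeckeAction P n) (u : List (Fin (n - 1))) (m : MaxChain P n) :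
    A.rep (HeckeZero.word u) (Finsupp.single m 1) =
      Finsupp.single (A.act u m) ((-1) ^ u.length) := by
  induction u with
  | nil => simp [HeckeZero.word]
  | cons i u ih =>
    have h : HeckeZero.word (i :: u) = HeckeZero.T n i * HeckeZero.word u := by
      simp [HeckeZero.word]
    rw [h, map_mul, Module.End.mul_apply, ih, rep, HeckeZero.lift_T, op_single, act_cons,
      List.length_cons, pow_succ, mul_neg_one]

/-- The character counts the maximal chains fixed by a word, up to sign. -/
theorem character_word [Finite P] (A : LocalHeckeAction P n) (u : List (Fin (n - 1))) :
    A.character (HeckeZero.word u) = (-1) ^ u.length * (Nat.card {m // A.act u m = m} : ℂ) := by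
  classical
  have := Fintype.ofFinite (MaxChain P n)
  change LinearMap.trace ℂ _ (A.rep (HeckeZero.word u)) = _
  rw [LinearMap.trace_eq_matrix_trace ℂ Finsupp.basisSingleOne, Matrix.trace]
  have h : ∀ m : MaxChain P n, Matrix.diag (LinearMap.toMatrix Finsupp.basisSingleOne
      Finsupp.basisSingleOne (A.rep (HeckeZero.word u))) m =
      if A.act u m = m then (-1) ^ u.length else 0 := by
    intro m
    rw [Matrix.diag_apply, LinearMap.toMatrix_apply, Finsupp.coe_basisSingleOne,
      A.rep_word_single, Finsupp.basisSingleOne_repr, LinearEquiv.refl_apply,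
      Finsupp.single_apply]
  rw [Finset.sum_congr rfl fun m _ => h m, Finset.sum_ite, Finset.sum_const_zero, add_zero,
    Finset.sum_const, nsmul_eq_mul, mul_comm, Nat.card_eq_fintype_card, Fintype.card_subtype]

/-- The only maximal chains fixed by a word are those fixed by each of its letters. -/
def IsTriangular (A : LocalHeckeAction P n) : Prop :=
  ∀ u m, A.act u m = m → ∀ i ∈ u, A.U i m = m

/-- For each set `J` of ranks, a maximal chain can be changed in exactly one way at the ranks in
`J` to a maximal chain that is fixed by the `U_j` with `j ∈ J`. -/
def HasUniqueFixed (A : LocalHeckeAction P n) : Prop :=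
  ∀ (J : Finset (Fin (n - 1))) m, ∃! m', AgreeOff J m' m ∧ ∀ j ∈ J, A.U j m' = m'

/-- The descent set of a maximal chain: the indices `i` with `U_i m ≠ m`. -/
noncomputable def descents (A : LocalHeckeAction P n) (m : MaxChain P n) : Finset (Fin (n - 1)) :=
  by classical exact Finset.univ.filter fun i => A.U i m ≠ m

theorem mem_descents (A : LocalHeckeAction P n) {m : MaxChain P n} {i : Fin (n - 1)} :
    i ∈ A.descents m ↔ A.U i m ≠ m := by
  simp [descents]

theorem character_eq_sum [Finite P] [Fintype (MaxChain P n)] (A : LocalHeckeAction P n)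
    (hA : A.IsTriangular) : A.character = ∑ m, irrChar n (A.descents m)ᶜ := by
  classical
  refine LinearMap.ext_on (HeckeZero.span_range_word n) ?_
  rintro _ ⟨u, rfl⟩
  rw [character_word, LinearMap.sum_apply]
  simp only [irrChar_word]
  rw [Finset.sum_ite, Finset.sum_const_zero, add_zero, Finset.sum_const, nsmul_eq_mul, mul_comm,
    Nat.card_eq_fintype_card, Fintype.card_subtype]
  congr 3
  ext m
  simp only [Finset.mem_filter, Finset.mem_univ, true_and, Finset.subset_iff, List.mem_toFinset,
    Finset.mem_compl, mem_descents, not_not]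
  exact ⟨fun h i hi => hA u m h i hi, fun h => A.act_eq_self fun i hi => h hi⟩

end Action

end LocalHeckeAction

/-! ### Ehrenborg's series as a sum of fundamental quasisymmetric functions -/

theorem fundamental_apply_wordWeight {n : ℕ} {f : Fin n → ℕ} (hf : Monotone f)
    (T : Finset (Fin (n - 1))) :
    fundamental n T (wordWeight f) = if Disjoint T (flatSet f) then 1 else 0 := by
  have hd : Disjoint T (flatSet f) ↔ ∀ j ∈ T, f ⟨j, by omega⟩ < f ⟨j + 1, by omega⟩ := by
    simp [Finset.disjoint_left, flatSet]
  unfold fundamental monomialSum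
  split_ifs with h <;> rw [hd] at h
  · rw [Nat.card_eq_one_iff_exists.2, Nat.cast_one]
    refine ⟨⟨⟨f, hf, h⟩, rfl⟩, ?_⟩
    rintro ⟨⟨g, hg, _⟩, hw⟩
    exact Subtype.ext (Subtype.ext (monotone_eq_of_weight_eq hg hf hw))
  · have : IsEmpty {a : FundSeq n T // ∑ j, Finsupp.single (a.1 j) 1 = wordWeight f} := by
      refine ⟨?_⟩
      rintro ⟨⟨g, hg, hT⟩, hw⟩
      obtain rfl := monotone_eq_of_weight_eq hg hf hw
      exact h hT
    rw [Nat.card_of_isEmpty, Nat.cast_zero]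

theorem ehrenborg_apply {P : Type*} [PartialOrder P] [BoundedOrder P] [GradeMinOrder ℕ P]
    (d : ℕ →₀ ℕ) :
    ehrenborg P d = (Nat.card {c : Multichain P // multichainWeight c = d} : ℂ) := rfl

section Good

variable {P : Type*} [PartialOrder P] [Finite P] [BoundedOrder P] [GradeMinOrder ℕ P] {n : ℕ}

namespace LocalHeckeAction

theorem HasUniqueFixed.card_multichain {A : LocalHeckeAction P n} (hA : A.HasUniqueFixed)
    (hn : grade ℕ (⊤ : P) = n) {f : Fin n → ℕ} (hf : Monotone f) :
    Nat.card {c : Multichain P // multichainWeight c = wordWeight f} =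
      Nat.card {m // Disjoint (A.descents m) (flatSet f)} := by
  obtain ⟨Φ, hΦ, hΦ'⟩ := exists_multichain_map hn hf
  have hd : ∀ m, Disjoint (A.descents m) (flatSet f) ↔ ∀ j ∈ flatSet f, A.U j m = m := by
    intro m
    simp only [Finset.disjoint_right, mem_descents, not_not]
  refine (Nat.card_eq_of_bijective (fun m : {m // Disjoint (A.descents m) (flatSet f)} => Φ m.1)
    ⟨?_, ?_⟩).symm
  · rintro ⟨m, hm⟩ ⟨m', hm'⟩ h
    exact Subtype.ext ((hA (flatSet f) m').unique ⟨(hΦ' _ _).1 h, (hd m).1 hm⟩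
      ⟨fun _ _ => rfl, (hd m').1 hm'⟩)
  · intro c
    obtain ⟨m, rfl⟩ := hΦ c
    obtain ⟨m', ⟨h1, h2⟩, _⟩ := hA (flatSet f) m
    exact ⟨⟨m', (hd m').2 h2⟩, (hΦ' _ _).2 h1⟩

theorem HasUniqueFixed.ehrenborg_eq_sum [Fintype (MaxChain P n)] {A : LocalHeckeAction P n}
    (hA : A.HasUniqueFixed) (hn : grade ℕ (⊤ : P) = n) :
    ehrenborg P = ∑ m, fundamental n (A.descents m) := by
  classical
  funext d
  have hsum : (∑ m, fundamental n (A.descents m)) d = ∑ m, fundamental n (A.descents m) d :=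
    map_sum (MvPowerSeries.coeff (R := ℂ) d) _ _
  rw [hsum]
  by_cases hd : ∃ f : Fin n → ℕ, Monotone f ∧ wordWeight f = d
  · obtain ⟨f, hf, rfl⟩ := hd
    simp only [fundamental_apply_wordWeight hf]
    rw [ehrenborg_apply, hA.card_multichain hn hf, Nat.card_eq_fintype_card,
      Fintype.card_subtype, Finset.sum_boole]
  · have h1 : IsEmpty {c : Multichain P // multichainWeight c = d} := by
      refine ⟨?_⟩
      rintro ⟨c, rfl⟩
      exact hd (exists_wordWeight_eq hn c)
    rw [ehrenborg_apply, Nat.card_of_isEmpty, Nat.cast_zero]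
    refine (Finset.sum_eq_zero fun m _ => ?_).symm
    have h2 : IsEmpty {a : FundSeq n (A.descents m) // ∑ j, Finsupp.single (a.1 j) 1 = d} := by
      refine ⟨?_⟩
      rintro ⟨a, rfl⟩
      exact hd ⟨a.1, a.2.1, rfl⟩
    unfold fundamental monomialSum
    rw [Nat.card_of_isEmpty, Nat.cast_zero]

/-- An action that is triangular and has unique fixed extensions is good: both `ω F_P` and the
characteristic of its character are the sum of the `L_{S, n}` over the complements `S` of the
descent sets of the maximal chains. -/
theorem isGood_of_isTriangular_of_hasUniqueFixed {A : LocalHeckeAction P n}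
    (hT : A.IsTriangular) (hF : A.HasUniqueFixed) (hn : grade ℕ (⊤ : P) = n) : A.IsGood := by
  have := Fintype.ofFinite (MaxChain P n)
  have h1 := hF.ehrenborg_eq_sum hn
  have h2 := A.character_eq_sum hT
  refine ⟨?_, ?_, ?_⟩
  · rw [h1]
    exact Submodule.sum_mem _ fun m _ => Submodule.subset_span ⟨_, rfl⟩
  · rw [h2]
    exact Submodule.sum_mem _ fun m _ => Submodule.subset_span ⟨_, rfl⟩
  · have h3 : (⟨ehrenborg P, by
        rw [h1]; exact Submodule.sum_mem _ fun m _ => Submodule.subset_span ⟨_, rfl⟩⟩ : QSym n) =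
        ∑ m, ⟨fundamental n (A.descents m), Submodule.subset_span ⟨_, rfl⟩⟩ := by
      ext1
      simp [h1]
    have h4 : (⟨A.character, by
        rw [h2]; exact Submodule.sum_mem _ fun m _ => Submodule.subset_span ⟨_, rfl⟩⟩ :
          CharSpace n) =
        ∑ m, ⟨irrChar n (A.descents m)ᶜ, Submodule.subset_span ⟨_, rfl⟩⟩ := by
      ext1
      simp [h2]
    rw [h3, h4, map_sum, map_sum]
    simp only [omega_fundamental, ch_irrChar]

/-- For a good action, the number of maximal chains fixed by a word depends only on the set of its
letters: it is the number of chains of `P` that occupy exactly the complementary ranks. -/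
theorem IsGood.card_fixed {A : LocalHeckeAction P n} (hA : A.IsGood) (u : List (Fin (n - 1))) :
    Nat.card {m // A.act u m = m} =
      Nat.card {c : Multichain P //
        multichainWeight c = wordWeight (canonSeq n u.toFinsetᶜ)} := by
  classical
  obtain ⟨hF, hχ, h⟩ := hA
  obtain ⟨a, ha⟩ := (Submodule.mem_span_range_iff_exists_fun ℂ).1 hF
  obtain ⟨b, hb⟩ := (Submodule.mem_span_range_iff_exists_fun ℂ).1 hχ
  have ha' : (⟨ehrenborg P, hF⟩ : QSym n) =
      ∑ S, a S • ⟨fundamental n S, Submodule.subset_span ⟨_, rfl⟩⟩ := by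
    ext1
    simp [ha]
  have hb' : (⟨A.character, hχ⟩ : CharSpace n) =
      ∑ S, b S • ⟨irrChar n S, Submodule.subset_span ⟨_, rfl⟩⟩ := by
    ext1
    simp [hb]
  rw [ha', hb', map_sum, map_sum] at h
  simp only [map_smul, omega_fundamental, ch_irrChar] at h
  have hab : ∀ S, a Sᶜ = b S := by
    have h1 : ∑ S, a S • fundamental n Sᶜ = ∑ S, a Sᶜ • fundamental n S :=
      Fintype.sum_equiv (compl_involutive.toPerm) _ _ fun S => by simp
    rw [h1, ← sub_eq_zero, ← Finset.sum_sub_distrib] at h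
    simp only [← sub_smul] at h
    intro S
    exact sub_eq_zero.1 (Fintype.linearIndependent_iff.1 (fundamental_linearIndependent n) _ h S)
  have hF' : ehrenborg P (wordWeight (canonSeq n u.toFinsetᶜ)) =
      ∑ T, if u.toFinset ⊆ T then b T else 0 := by
    have hsum : (∑ S, a S • fundamental n S) (wordWeight (canonSeq n u.toFinsetᶜ)) =
        ∑ S, (a S • fundamental n S) (wordWeight (canonSeq n u.toFinsetᶜ)) :=
      map_sum (MvPowerSeries.coeff (R := ℂ) (wordWeight (canonSeq n u.toFinsetᶜ)))
        (fun S => a S • fundamental n S) Finset.univ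
    rw [← ha, hsum]
    refine Fintype.sum_equiv compl_involutive.toPerm _ _ fun S => ?_
    refine (congrArg (a S * ·) (coeff_fundamental n u.toFinsetᶜ S)).trans ?_
    have h1 : S ⊆ u.toFinsetᶜ ↔ u.toFinset ⊆ Sᶜ := Finset.subset_compl_comm
    simp [← hab, h1]
  have hχ' : A.character (HeckeZero.word u) =
      (-1) ^ u.length * ∑ T, if u.toFinset ⊆ T then b T else 0 := by
    rw [← hb, LinearMap.sum_apply, Finset.mul_sum]
    refine Finset.sum_congr rfl fun S _ => ?_
    rw [LinearMap.smul_apply, irrChar_word, smul_eq_mul]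
    split_ifs <;> ring
  rw [character_word, ← hF', ehrenborg_apply] at hχ'
  exact_mod_cast mul_left_cancel₀ (pow_ne_zero _ (by norm_num)) hχ'

end LocalHeckeAction

end Good

/-! ### Labels along chains -/

theorem monotone_of_le_succ {k : ℕ} {f : Fin k → ℤ}
    (h : ∀ (i : ℕ) (hi : i + 1 < k), f ⟨i, by omega⟩ ≤ f ⟨i + 1, hi⟩) : Monotone f := by
  rcases k with _ | k
  · exact fun a => a.elim0
  · exact Fin.monotone_iff_le_succ.2 fun i => h i (by omega)

section Labels

variable {P : Type*} [PartialOrder P]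

open Classical in
/-- An edge-labeling as a function of two elements, with the value `0` unless `x ⋖ y`. -/
noncomputable def edgeLabel (lab : Edge P → ℤ) (x y : P) : ℤ :=
  if h : x ⋖ y then lab ⟨(x, y), h⟩ else 0

/-- The label of the step of a chain from position `r` to position `r + 1`. -/
noncomputable def stepLabel (lab : Edge P → ℤ) {s t : P} {k : ℕ} (m : SatChain s t k) (r : ℕ) : ℤ :=
  edgeLabel lab (m.node r) (m.node (r + 1))

theorem labels_apply (lab : Edge P → ℤ) {s t : P} {k : ℕ} (m : SatChain s t k) (i : Fin k) :
    m.labels lab i = stepLabel lab m i := by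
  have h := m.node_covBy i.2
  rw [stepLabel, edgeLabel, dif_pos h, SatChain.labels]
  congr 3 <;> exact m.elem_eq_node _

theorem labels_monotone_iff (lab : Edge P → ℤ) {s t : P} {k : ℕ} (m : SatChain s t k) :
    Monotone (m.labels lab) ↔ ∀ r, r + 1 < k → stepLabel lab m r ≤ stepLabel lab m (r + 1) := by
  constructor
  · intro h r hr
    have := h (show (⟨r, by omega⟩ : Fin k) ≤ ⟨r + 1, hr⟩ from Nat.le_succ r)
    rwa [labels_apply, labels_apply] at this
  · intro h
    refine monotone_of_le_succ fun i hi => ?_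
    rw [labels_apply, labels_apply]
    exact h i hi

theorem AgreeOff.stepLabel_eq [BoundedOrder P] {n : ℕ} {lab : Edge P → ℤ}
    {J : Finset (Fin (n - 1))} {m m' : MaxChain P n}
    (h : AgreeOff J m m') {r : ℕ} (hr : ∀ j ∈ J, r ≠ j ∧ r ≠ j + 1) :
    stepLabel lab m r = stepLabel lab m' r := by
  rw [stepLabel, stepLabel, h r fun j hj => (hr j hj).2,
    h (r + 1) fun j hj => by have := (hr j hj).1; omega]

theorem IsELLabeling.exists_increasing [GradeOrder ℕ P] {lab : Edge P → ℤ}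
    (h : IsELLabeling lab) {s t : P} (hst : s ≤ t) {k : ℕ} (hk : grade ℕ t - grade ℕ s = k) :
    ∃ c : SatChain s t k, Monotone (c.labels lab) := by
  subst hk
  obtain ⟨c, hc, _⟩ := h s t hst
  exact ⟨c, hc⟩

theorem IsELLabeling.eq_of_monotone [GradeOrder ℕ P] {lab : Edge P → ℤ}
    (h : IsELLabeling lab) {s t : P} (hst : s ≤ t) {k : ℕ} (hk : grade ℕ t - grade ℕ s = k)
    {c c' : SatChain s t k} (hc : Monotone (c.labels lab)) (hc' : Monotone (c'.labels lab)) :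
    c = c' := by
  subst hk
  obtain ⟨c₀, _, h₀⟩ := h s t hst
  have key : ∀ d : SatChain s t (grade ℕ t - grade ℕ s), Monotone (d.labels lab) → d = c₀ := by
    intro d hd
    by_contra hne
    exact (h₀ d hne).1 hd
  rw [key c hc, key c' hc']

end Labels

/-! ### The action defined by an `S_n` EL-labeling -/

section Forward

variable {P : Type*} [PartialOrder P] [BoundedOrder P] [GradeMinOrder ℕ P] {n : ℕ}
  {lab : Edge P → ℤ}

theorem IsSnELLabeling.exists_perm (h : IsSnELLabeling n lab) (m : MaxChain P n) :
    ∃ σ : Equiv.Perm (Fin n), ∀ (r : ℕ) (hr : r < n), stepLabel lab m r = (σ ⟨r, hr⟩ : ℕ) + 1 := by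
  obtain ⟨σ, hσ⟩ := h.2 m
  refine ⟨σ, fun r hr => ?_⟩
  rw [← hσ, labels_apply]

theorem IsSnELLabeling.stepLabel_inj (h : IsSnELLabeling n lab) (m : MaxChain P n) {r r' : ℕ}
    (hr : r < n) (hr' : r' < n) (heq : stepLabel lab m r = stepLabel lab m r') : r = r' := by
  obtain ⟨σ, hσ⟩ := h.exists_perm m
  rw [hσ r hr, hσ r' hr'] at heq
  have : σ ⟨r, hr⟩ = σ ⟨r', hr'⟩ := Fin.ext (by omega)
  simpa using this

theorem IsSnELLabeling.stepLabel_swap (h : IsSnELLabeling n lab) {m m' : MaxChain P n}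
    {i : Fin (n - 1)} (hm : AgreeOff {i} m' m) :
    (stepLabel lab m' i = stepLabel lab m i ∧
      stepLabel lab m' (i + 1) = stepLabel lab m (i + 1)) ∨
    (stepLabel lab m' i = stepLabel lab m (i + 1) ∧
      stepLabel lab m' (i + 1) = stepLabel lab m i) := by
  obtain ⟨τ, hτ⟩ := h.exists_perm m
  have key : ∀ q : ℕ, q < n → (q = i ∨ q = i + 1) →
      stepLabel lab m' q = stepLabel lab m i ∨ stepLabel lab m' q = stepLabel lab m (i + 1) := by
    intro q hq hqi
    obtain ⟨σ, hσ⟩ := h.exists_perm m'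
    set p := τ.symm (σ ⟨q, hq⟩) with hp
    have h1 : stepLabel lab m p = stepLabel lab m' q := by
      rw [hτ p p.2, hσ q hq]
      simp [hp]
    by_cases h2 : (p : ℕ) = i ∨ (p : ℕ) = i + 1
    · rcases h2 with h2 | h2
      · left; rw [← h1, h2]
      · right; rw [← h1, h2]
    · have h3 : stepLabel lab m' p = stepLabel lab m p :=
        hm.stepLabel_eq (by simp only [Finset.mem_singleton, forall_eq]; omega)
      have := h.stepLabel_inj m' p.2 hq (h3.trans h1)
      omega
  have hi := i.2
  have hne : stepLabel lab m' i ≠ stepLabel lab m' (i + 1) := fun heq => by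
    have := h.stepLabel_inj m' (by omega) (by omega) heq
    omega
  have h1 := key i (by omega) (by omega)
  have h2 := key (i + 1) (by omega) (by omega)
  omega

/-- A maximal chain is determined by its elements at the ranks outside `J` if its labels increase
around each rank in `J`: between consecutive ranks outside `J` it is the increasing chain. -/
theorem IsSnELLabeling.eq_of_agreeOff (h : IsSnELLabeling n lab)
    {J : Finset (Fin (n - 1))} {m m' : MaxChain P n} (hJ : AgreeOff J m m')
    (hm : ∀ j ∈ J, stepLabel lab m j < stepLabel lab m (j + 1))
    (hm' : ∀ j ∈ J, stepLabel lab m' j < stepLabel lab m' (j + 1)) : m = m' := by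
  classical
  refine SatChain.ext_node fun r => ?_
  rcases le_or_gt n r with hr | hr
  · rw [m.node_of_ge hr, m'.node_of_ge hr]
  let Q : ℕ → Prop := fun q => ∀ j ∈ J, q ≠ j + 1
  have hQ : ∀ q, ¬ Q q → ∃ j ∈ J, q = j + 1 := fun q hq => by simpa [Q] using hq
  have hQn : Q n := fun j _ => by omega
  have hex : ∃ b, r ≤ b ∧ Q b := ⟨n, hr.le, hQn⟩
  have ha0 : Q (Nat.findGreatest Q r) :=
    Nat.findGreatest_spec (P := Q) (Nat.zero_le r) fun j _ => by omega
  have har : Nat.findGreatest Q r ≤ r := Nat.findGreatest_le r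
  have hamax : ∀ q, Nat.findGreatest Q r < q → q ≤ r → ¬ Q q := fun q h1 h2 =>
    Nat.findGreatest_is_greatest h1 h2
  obtain ⟨hbr, hb0⟩ := Nat.find_spec hex
  have hbn : Nat.find hex ≤ n := Nat.find_min' hex ⟨hr.le, hQn⟩
  have hbmin : ∀ q, q < Nat.find hex → r ≤ q → ¬ Q q := fun q h1 h2 h3 =>
    Nat.find_min hex h1 ⟨h2, h3⟩
  generalize Nat.findGreatest Q r = a at *
  generalize Nat.find hex = b at *
  have hin : ∀ q, a < q → q < b → ∃ j ∈ J, q = j + 1 := by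
    intro q h1 h2
    rcases le_total q r with h3 | h3
    · exact hQ q (hamax q h1 h3)
    · exact hQ q (hbmin q h2 h3)
  obtain ⟨l, rfl⟩ := Nat.exists_eq_add_of_le (har.trans hbr)
  obtain ⟨c, hc⟩ := m.exists_restrict hbn rfl rfl
  obtain ⟨c', hc'⟩ := m'.exists_restrict hbn (hJ a ha0).symm (hJ _ hb0).symm
  have hmono : ∀ (d : MaxChain P n) (e : SatChain (m.node a) (m.node (a + l)) l),
      (∀ r ≤ l, e.node r = d.node (a + r)) →
      (∀ j ∈ J, stepLabel lab d j < stepLabel lab d (j + 1)) → Monotone (e.labels lab) := by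
    intro d e he hd
    rw [labels_monotone_iff]
    intro q hq
    obtain ⟨j, hj, hqj⟩ := hin (a + q + 1) (by omega) (by omega)
    have h1 := hd j hj
    obtain hj' : (j : ℕ) = a + q := by omega
    rw [hj'] at h1
    rw [stepLabel, stepLabel, he q (by omega), he (q + 1) (by omega), he (q + 1 + 1) (by omega)]
    exact h1.le
  have hcc : c = c' := by
    refine h.1.eq_of_monotone (m.node_mono (by omega)) ?_ (hmono m c hc hm) (hmono m' c' hc' hm')
    rw [grade_node_max m hbn, grade_node_max m (by omega)]
    omega
  obtain ⟨q, rfl⟩ := Nat.exists_eq_add_of_le har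
  rw [← hc q (by omega), ← hc' q (by omega), hcc]

theorem IsSnELLabeling.exists_sort (h : IsSnELLabeling n lab) (i : Fin (n - 1))
    (m : MaxChain P n) :
    ∃ m' : MaxChain P n, AgreeOff {i} m' m ∧ stepLabel lab m' i < stepLabel lab m' (i + 1) := by
  have hi := i.2
  obtain ⟨c, hc⟩ := h.1.exists_increasing (m.node_mono (show (i : ℕ) ≤ i + 2 by omega)) (k := 2)
    (by rw [grade_node_max m (by omega), grade_node_max m (by omega)]; omega)
  obtain ⟨m', h1, h2⟩ := m.exists_splice c (by omega) rfl rfl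
  refine ⟨m', fun r hr => h1 r ?_, ?_⟩
  · have := hr i (by simp)
    omega
  · refine lt_of_le_of_ne ?_ fun heq => ?_
    · have h3 := (labels_monotone_iff lab c).1 hc 0 (by omega)
      rw [stepLabel, stepLabel, ← h2 0 (by omega), ← h2 (0 + 1) (by omega),
        ← h2 (0 + 1 + 1) (by omega)] at h3
      exact h3
    · have := h.stepLabel_inj m' (by omega) (by omega) heq
      omega

/-- The maximal chain obtained from `m` by replacing its part of rank `i` to `i + 2` by the
increasing chain of that interval. -/
noncomputable def IsSnELLabeling.sort (h : IsSnELLabeling n lab) (i : Fin (n - 1))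
    (m : MaxChain P n) : MaxChain P n :=
  (h.exists_sort i m).choose

theorem IsSnELLabeling.agreeOff_sort (h : IsSnELLabeling n lab) (i : Fin (n - 1))
    (m : MaxChain P n) : AgreeOff {i} (h.sort i m) m :=
  (h.exists_sort i m).choose_spec.1

theorem IsSnELLabeling.stepLabel_sort_lt (h : IsSnELLabeling n lab) (i : Fin (n - 1))
    (m : MaxChain P n) :
    stepLabel lab (h.sort i m) i < stepLabel lab (h.sort i m) (i + 1) :=
  (h.exists_sort i m).choose_spec.2

theorem IsSnELLabeling.sort_eq_self (h : IsSnELLabeling n lab) {i : Fin (n - 1)}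
    {m : MaxChain P n} (hm : stepLabel lab m i < stepLabel lab m (i + 1)) : h.sort i m = m :=
  h.eq_of_agreeOff (h.agreeOff_sort i m) (by simpa using h.stepLabel_sort_lt i m) (by simpa using hm)

theorem IsSnELLabeling.stepLabel_sort_of_ne (h : IsSnELLabeling n lab) (i : Fin (n - 1))
    (m : MaxChain P n) {r : ℕ} (h1 : r ≠ i) (h2 : r ≠ i + 1) :
    stepLabel lab (h.sort i m) r = stepLabel lab m r :=
  (h.agreeOff_sort i m).stepLabel_eq (by simpa using ⟨h1, h2⟩)

theorem IsSnELLabeling.stepLabel_sort (h : IsSnELLabeling n lab) (i : Fin (n - 1))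
    (m : MaxChain P n) :
    stepLabel lab (h.sort i m) i = min (stepLabel lab m i) (stepLabel lab m (i + 1)) ∧
    stepLabel lab (h.sort i m) (i + 1) = max (stepLabel lab m i) (stepLabel lab m (i + 1)) := by
  have h1 := h.stepLabel_sort_lt i m
  have h2 := h.stepLabel_swap (h.agreeOff_sort i m)
  omega

theorem IsSnELLabeling.sort_comm (h : IsSnELLabeling n lab) {i j : Fin (n - 1)}
    (hij : (i : ℕ) + 2 ≤ j) (m : MaxChain P n) : h.sort i (h.sort j m) = h.sort j (h.sort i m) := by
  have hi : ({i} : Finset (Fin (n - 1))) ⊆ {i, j} := by simp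
  have hj : ({j} : Finset (Fin (n - 1))) ⊆ {i, j} := by simp
  refine h.eq_of_agreeOff (J := {i, j}) ?_ ?_ ?_
  · exact (((h.agreeOff_sort i _).mono hi).trans ((h.agreeOff_sort j _).mono hj)).trans
      (((h.agreeOff_sort j _).mono hj).trans ((h.agreeOff_sort i _).mono hi)).symm
  · simp only [Finset.mem_insert, Finset.mem_singleton, forall_eq_or_imp, forall_eq]
    refine ⟨h.stepLabel_sort_lt _ _, ?_⟩
    rw [h.stepLabel_sort_of_ne i _ (by omega) (by omega),
      h.stepLabel_sort_of_ne i _ (by omega) (by omega)]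
    exact h.stepLabel_sort_lt _ _
  · simp only [Finset.mem_insert, Finset.mem_singleton, forall_eq_or_imp, forall_eq]
    refine ⟨?_, h.stepLabel_sort_lt _ _⟩
    rw [h.stepLabel_sort_of_ne j _ (by omega) (by omega),
      h.stepLabel_sort_of_ne j _ (by omega) (by omega)]
    exact h.stepLabel_sort_lt _ _

/-- Both sides of the braid relation sort three consecutive labels. -/
theorem IsSnELLabeling.sort_braid (h : IsSnELLabeling n lab) {i j : Fin (n - 1)}
    (hij : (j : ℕ) = i + 1) (m : MaxChain P n) :
    h.sort i (h.sort j (h.sort i m)) = h.sort j (h.sort i (h.sort j m)) := by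
  have hi : ({i} : Finset (Fin (n - 1))) ⊆ {i, j} := by simp
  have hj : ({j} : Finset (Fin (n - 1))) ⊆ {i, j} := by simp
  have hsi : ∀ m, AgreeOff {i, j} (h.sort i m) m := fun m => (h.agreeOff_sort i _).mono hi
  have hsj : ∀ m, AgreeOff {i, j} (h.sort j m) m := fun m => (h.agreeOff_sort j _).mono hj
  have hi1 := fun m => (h.stepLabel_sort i m).1
  have hi2 := fun m => (h.stepLabel_sort i m).2
  have hi3 := fun m => h.stepLabel_sort_of_ne i m (r := i + 1 + 1) (by omega) (by omega)
  have hj1 := fun m => (h.stepLabel_sort j m).1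
  have hj2 := fun m => (h.stepLabel_sort j m).2
  have hj3 := fun m => h.stepLabel_sort_of_ne j m (r := i) (by omega) (by omega)
  rw [hij] at hj1 hj2
  have hj4 := j.2
  have h12 : stepLabel lab m i ≠ stepLabel lab m (i + 1) := fun heq => by
    have := h.stepLabel_inj m (by omega) (by omega) heq
    omega
  have h13 : stepLabel lab m i ≠ stepLabel lab m (i + 1 + 1) := fun heq => by
    have := h.stepLabel_inj m (by omega) (by omega) heq
    omega
  have h23 : stepLabel lab m (i + 1) ≠ stepLabel lab m (i + 1 + 1) := fun heq => by
    have := h.stepLabel_inj m (by omega) (by omega) heq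
    omega
  refine h.eq_of_agreeOff (J := {i, j}) ?_ ?_ ?_
  · exact ((hsi _).trans ((hsj _).trans (hsi _))).trans
      ((hsj _).trans ((hsi _).trans (hsj _))).symm
  · simp only [Finset.mem_insert, Finset.mem_singleton, forall_eq_or_imp, forall_eq]
    refine ⟨h.stepLabel_sort_lt _ _, ?_⟩
    rw [hij]
    simp only [hi1, hi2, hi3, hj1, hj2, hj3]
    omega
  · simp only [Finset.mem_insert, Finset.mem_singleton, forall_eq_or_imp, forall_eq]
    refine ⟨?_, h.stepLabel_sort_lt _ _⟩
    simp only [hi1, hi2, hi3, hj1, hj2, hj3]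
    omega

/-- The local action of an `S_n` EL-labeling: `U_i` sorts the labels around rank `i`. -/
noncomputable def IsSnELLabeling.action (h : IsSnELLabeling n lab) : LocalHeckeAction P n where
  U := h.sort
  isLocal i m j hj := by
    rw [SatChain.elem_eq_node, SatChain.elem_eq_node]
    exact h.agreeOff_sort i m j (by simpa using hj)
  idem i m := h.sort_eq_self (h.stepLabel_sort_lt i m)
  comm i j hij m := h.sort_comm hij m
  braid i j hij m := h.sort_braid hij m

/-- Sorting lowers the label sequence lexicographically. -/
theorem IsSnELLabeling.labels_sort_lt (h : IsSnELLabeling n lab) {i : Fin (n - 1)}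
    {m : MaxChain P n} (hne : h.sort i m ≠ m) :
    toLex ((h.sort i m).labels lab) < toLex (m.labels lab) := by
  have hi := i.2
  refine ⟨⟨i, by omega⟩, fun q hq => ?_, ?_⟩
  · have hq' : (q : ℕ) < i := hq
    change (h.sort i m).labels lab q = m.labels lab q
    rw [labels_apply, labels_apply, h.stepLabel_sort_of_ne i m (by omega) (by omega)]
  · change (h.sort i m).labels lab _ < m.labels lab _
    rw [labels_apply, labels_apply]
    have h1 : ¬ stepLabel lab m i < stepLabel lab m (i + 1) := fun h1 => hne (h.sort_eq_self h1)
    have h2 := (h.stepLabel_sort i m).1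
    have h3 : stepLabel lab m i ≠ stepLabel lab m (i + 1) := fun heq => by
      have := h.stepLabel_inj m (by omega) (by omega) heq
      omega
    simp only
    omega

theorem IsSnELLabeling.labels_sort_le (h : IsSnELLabeling n lab) (i : Fin (n - 1))
    (m : MaxChain P n) : toLex ((h.sort i m).labels lab) ≤ toLex (m.labels lab) := by
  by_cases hne : h.sort i m = m
  · rw [hne]
  · exact (h.labels_sort_lt hne).le

theorem IsSnELLabeling.labels_act_le (h : IsSnELLabeling n lab) (u : List (Fin (n - 1)))
    (m : MaxChain P n) : toLex ((h.action.act u m).labels lab) ≤ toLex (m.labels lab) := by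
  induction u with
  | nil => exact le_rfl
  | cons i u ih => exact (h.labels_sort_le i _).trans ih

theorem IsSnELLabeling.isTriangular (h : IsSnELLabeling n lab) : h.action.IsTriangular := by
  intro u m hu
  induction u with
  | nil => simp
  | cons i u ih =>
    have h1 : h.sort i (h.action.act u m) = h.action.act u m := by
      by_contra hne
      have h2 := (h.labels_sort_lt hne).trans_le (h.labels_act_le u m)
      have h3 : h.sort i (h.action.act u m) = m := hu
      rw [h3] at h2
      exact lt_irrefl _ h2
    have h2 : h.action.act u m = m := h1.symm.trans hu
    rw [h2] at h1
    intro j hj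
    rcases List.mem_cons.1 hj with rfl | hj
    · exact h1
    · exact ih h2 j hj

theorem IsSnELLabeling.hasUniqueFixed [Finite P] (h : IsSnELLabeling n lab) :
    h.action.HasUniqueFixed := by
  intro J m
  -- A lexicographically least chain that agrees with `m` outside `J` is fixed.
  obtain ⟨m', hm', hmin⟩ := Set.exists_min_image {m' : MaxChain P n | AgreeOff J m' m}
    (fun m' => toLex (m'.labels lab)) (Set.toFinite _) ⟨m, fun _ _ => rfl⟩
  have hlt : ∀ m' : MaxChain P n, ∀ j, h.action.U j m' = m' →
      stepLabel lab m' j < stepLabel lab m' (j + 1) := by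
    intro m' j hj
    have h1 := h.stepLabel_sort_lt j m'
    have h2 : h.sort j m' = m' := hj
    rwa [h2] at h1
  have hfix : ∀ j ∈ J, h.action.U j m' = m' := by
    intro j hj
    by_contra hne
    refine absurd (h.labels_sort_lt hne) (not_lt.2 (hmin _ ?_))
    exact ((h.agreeOff_sort j m').mono (by simpa using hj)).trans hm'
  refine ⟨m', ⟨hm', hfix⟩, fun m'' hm'' => ?_⟩
  exact h.eq_of_agreeOff (hm''.1.trans hm'.symm) (fun j hj => hlt _ j (hm''.2 j hj))
    fun j hj => hlt _ j (hfix j hj)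

theorem IsSnELShellable.hasGoodHeckeAction [Finite P] (h : IsSnELShellable P n)
    (hn : grade ℕ (⊤ : P) = n) : HasGoodHeckeAction P n := by
  obtain ⟨lab, h⟩ := h
  exact ⟨h.action, LocalHeckeAction.isGood_of_isTriangular_of_hasUniqueFixed h.isTriangular
    h.hasUniqueFixed hn⟩

end Forward

namespace LocalHeckeAction

/-! ### Absorbing words -/

section Absorbing

variable {P : Type*} [PartialOrder P] [BoundedOrder P] {n : ℕ}

/-- The maps `U_r` indexed by all natural numbers, the identity for `r ≥ n - 1`. -/
def natU (A : LocalHeckeAction P n) (r : ℕ) (m : MaxChain P n) : MaxChain P n :=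
  if h : r < n - 1 then A.U ⟨r, h⟩ m else m

theorem natU_coe (A : LocalHeckeAction P n) (i : Fin (n - 1)) (m : MaxChain P n) :
    A.natU i m = A.U i m :=
  dif_pos i.2

theorem natU_idem (A : LocalHeckeAction P n) (r : ℕ) (m : MaxChain P n) :
    A.natU r (A.natU r m) = A.natU r m := by
  unfold natU
  split_ifs
  · exact A.idem _ _
  · rfl

theorem natU_comm (A : LocalHeckeAction P n) {r s : ℕ} (h : r + 2 ≤ s) (m : MaxChain P n) :
    A.natU r (A.natU s m) = A.natU s (A.natU r m) := by
  unfold natU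
  split_ifs
  · exact A.comm _ _ h m
  all_goals rfl

theorem natU_braid (A : LocalHeckeAction P n) (r : ℕ) (m : MaxChain P n) :
    A.natU r (A.natU (r + 1) (A.natU r m)) =
      A.natU (r + 1) (A.natU r (A.natU (r + 1) m)) := by
  unfold natU
  split_ifs
  · exact A.braid _ _ rfl m
  · exact A.idem _ _
  · omega
  · rfl

/-- The composite `U_a U_{a+1} ⋯ U_{a+d-1}`. -/
def run (A : LocalHeckeAction P n) (a : ℕ) : ℕ → MaxChain P n → MaxChain P n
  | 0, m => m
  | d + 1, m => A.natU a (A.run (a + 1) d m)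

theorem natU_run_comm (A : LocalHeckeAction P n) {i a : ℕ} (h : i + 2 ≤ a) (d : ℕ)
    (m : MaxChain P n) : A.natU i (A.run a d m) = A.run a d (A.natU i m) := by
  induction d generalizing a with
  | zero => rfl
  | succ d ih => rw [run, run, A.natU_comm h, ih (by omega)]

/-- Inside a run, `U_{j+1} (U_a ⋯ U_b) = (U_a ⋯ U_b) U_j`. -/
theorem natU_run_shift (A : LocalHeckeAction P n) {j a d : ℕ} (h1 : a ≤ j) (h2 : j + 1 < a + d)
    (m : MaxChain P n) : A.natU (j + 1) (A.run a d m) = A.run a d (A.natU j m) := by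
  induction d generalizing a with
  | zero => omega
  | succ d ih =>
    rcases h1.eq_or_lt with rfl | h1
    · obtain ⟨d, rfl⟩ := Nat.exists_eq_succ_of_ne_zero (show d ≠ 0 by omega)
      simp only [run]
      rw [← natU_braid, natU_run_comm A (by omega)]
    · rw [run, run, ← A.natU_comm (by omega), ih (by omega) (by omega)]

theorem exists_word_run (A : LocalHeckeAction P n) (a d : ℕ) :
    ∃ u : List (Fin (n - 1)), (∀ i, i ∈ u ↔ a ≤ (i : ℕ) ∧ (i : ℕ) < a + d) ∧
      ∀ m, A.act u m = A.run a d m := by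
  induction d generalizing a with
  | zero => exact ⟨[], fun i => by simp, fun m => rfl⟩
  | succ d ih =>
    obtain ⟨u, hu1, hu2⟩ := ih (a + 1)
    by_cases h : a < n - 1
    · refine ⟨⟨a, h⟩ :: u, fun i => ?_, fun m => ?_⟩
      · rw [List.mem_cons, hu1, Fin.ext_iff]
        simp only
        omega
      · rw [act_cons, hu2, run, natU, dif_pos h]
    · refine ⟨u, fun i => ?_, fun m => ?_⟩
      · rw [hu1]
        omega
      · rw [hu2, run, natU, dif_neg h]

/-- For each set `J` of generators there is a word in exactly these generators that absorbs each of
them on the left; it represents the longest element of the parabolic subgroup of `J`. It is built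
by prepending, for each `k ∈ J` in turn, the run of consecutive elements of `J` that ends in `k`. -/
theorem exists_absorbing_word (A : LocalHeckeAction P n) (J : Finset (Fin (n - 1))) :
    ∃ u : List (Fin (n - 1)), (∀ i, i ∈ u ↔ i ∈ J) ∧
      ∀ i ∈ J, ∀ m, A.U i (A.act u m) = A.act u m := by
  classical
  let Q : ℕ → Prop := fun r => ∃ j ∈ J, (j : ℕ) = r
  have hQ : ∀ i : Fin (n - 1), Q i ↔ i ∈ J := fun i => by simp [Q, ← Fin.ext_iff]
  have key : ∀ k, ∃ u : List (Fin (n - 1)), (∀ i, i ∈ u ↔ i ∈ J ∧ (i : ℕ) < k) ∧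
      ∀ r < k, Q r → ∀ m, A.natU r (A.act u m) = A.act u m := by
    intro k
    induction k with
    | zero => exact ⟨[], by simp, by simp⟩
    | succ k ih =>
      obtain ⟨u, hu1, hu2⟩ := ih
      by_cases hk : Q k
      · have hex : ∃ a, a ≤ k ∧ ∀ r, a ≤ r → r ≤ k → Q r :=
          ⟨k, le_rfl, fun r h1 h2 => le_antisymm h1 h2 ▸ hk⟩
        obtain ⟨hak, haQ⟩ := Nat.find_spec hex
        have hmin : ∀ r, Q r → r + 1 ≠ Nat.find hex := by
          intro r hr heq
          refine Nat.find_min hex (m := r) (by omega) ⟨by omega, fun q h1 h2 => ?_⟩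
          rcases h1.eq_or_lt with rfl | h1
          · exact hr
          · exact haQ q (by omega) h2
        generalize Nat.find hex = a at *
        obtain ⟨v, hv1, hv2⟩ := A.exists_word_run a (k + 1 - a)
        refine ⟨v ++ u, fun i => ?_, fun r hr hQr m => ?_⟩
        · rw [List.mem_append, hv1, hu1]
          constructor
          · rintro (⟨h1, h2⟩ | ⟨h1, h2⟩)
            · exact ⟨(hQ i).1 (haQ i h1 (by omega)), by omega⟩
            · exact ⟨h1, by omega⟩
          · rintro ⟨h1, h2⟩
            by_cases h3 : (i : ℕ) < k
            · exact Or.inr ⟨h1, h3⟩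
            · exact Or.inl (by omega)
        · rw [act_append, hv2]
          rcases lt_trichotomy r a with h | rfl | h
          · have := hmin r hQr
            rw [A.natU_run_comm (by omega), hu2 r (by omega) hQr]
          · obtain ⟨d, hd⟩ := Nat.exists_eq_succ_of_ne_zero (show k + 1 - r ≠ 0 by omega)
            rw [hd, run, natU_idem]
          · obtain ⟨r, rfl⟩ := Nat.exists_eq_succ_of_ne_zero (show r ≠ 0 by omega)
            rw [Nat.succ_eq_add_one, A.natU_run_shift (by omega) (by omega),
              hu2 r (by omega) (haQ r (by omega) (by omega))]
      · refine ⟨u, fun i => ?_, fun r hr hQr => ?_⟩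
        · rw [hu1]
          refine and_congr_right fun hi => ?_
          have : (i : ℕ) ≠ k := by
            rintro rfl
            exact hk ((hQ i).2 hi)
          omega
        · refine hu2 r ?_ hQr
          have : r ≠ k := by
            rintro rfl
            exact hk hQr
          omega
  obtain ⟨u, hu1, hu2⟩ := key (n - 1)
  refine ⟨u, fun i => ?_, fun i hi m => ?_⟩
  · rw [hu1]
    exact and_iff_left i.2
  · rw [← natU_coe]
    exact hu2 i i.2 ((hQ i).2 hi) m

end Absorbing

section GoodActions

variable {P : Type*} [PartialOrder P] [Finite P] [BoundedOrder P] [GradeMinOrder ℕ P] {n : ℕ}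
  {A : LocalHeckeAction P n}

/-- The fixed chains of an absorbing word are among those of any other word in the same letters, and
for a good action there are equally many of them. -/
theorem IsGood.isTriangular (hA : A.IsGood) : A.IsTriangular := by
  classical
  intro u m hm
  obtain ⟨v, hv1, hv2⟩ := A.exists_absorbing_word u.toFinset
  have hv : v.toFinset = u.toFinset := by
    ext i
    rw [List.mem_toFinset, hv1]
  have hfix : ∀ m, A.act v m = m → ∀ i ∈ u, A.U i m = m := by
    intro m hm i hi
    have := hv2 i (List.mem_toFinset.2 hi) m
    rwa [hm] at this
  have hsub : {m | A.act v m = m} ⊆ {m | A.act u m = m} := fun m hm =>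
    A.act_eq_self (hfix m hm)
  have hcard : Nat.card {m // A.act u m = m} = Nat.card {m // A.act v m = m} := by
    rw [hA.card_fixed, hA.card_fixed, hv]
  have heq : {m | A.act v m = m} = {m | A.act u m = m} :=
    Set.eq_of_subset_of_ncard_le hsub hcard.le (Set.toFinite _)
  have hm' : m ∈ {m | A.act v m = m} := heq ▸ hm
  exact hfix m hm'

theorem flatSet_canonSeq (n : ℕ) (S : Finset (Fin (n - 1))) : flatSet (canonSeq n S) = Sᶜ := by
  ext j
  simp [flatSet, canonSeq_lt]

/-- The chains fixed by an absorbing word for `J` represent all chains on the ranks outside `J`,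
and for a good action there are equally many of both. -/
theorem IsGood.hasUniqueFixed (hA : A.IsGood) (hn : grade ℕ (⊤ : P) = n) :
    A.HasUniqueFixed := by
  classical
  intro J m
  obtain ⟨v, hv1, hv2⟩ := A.exists_absorbing_word J
  have hv : v.toFinset = J := by
    ext i
    rw [List.mem_toFinset, hv1]
  have hagree : ∀ m, AgreeOff J (A.act v m) m := A.agreeOff_act fun i hi => (hv1 i).1 hi
  have hfix : ∀ m, (∀ j ∈ J, A.U j m = m) → A.act v m = m := fun m hm =>
    A.act_eq_self fun i hi => hm i ((hv1 i).1 hi)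
  obtain ⟨Φ, hΦ, hΦ'⟩ := exists_multichain_map hn (canonSeq_mono n Jᶜ)
  rw [flatSet_canonSeq, compl_compl] at hΦ'
  have hcard := hA.card_fixed v
  rw [hv] at hcard
  have hsurj : Function.Surjective fun m : {m // A.act v m = m} => Φ m.1 := by
    intro c
    obtain ⟨m, rfl⟩ := hΦ c
    exact ⟨⟨A.act v m, hfix _ fun j hj => hv2 j hj m⟩, (hΦ' _ _).2 (hagree m)⟩
  have hinj : Function.Injective fun m : {m // A.act v m = m} => Φ m.1 :=
    (hsurj.bijective_of_nat_card_le hcard.le).1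
  refine ⟨A.act v m, ⟨hagree m, fun j hj => hv2 j hj m⟩, fun m' hm' => ?_⟩
  have := @hinj ⟨m', hfix m' hm'.2⟩ ⟨A.act v m, hfix _ fun j hj => hv2 j hj m⟩
    ((hΦ' _ _).2 (hm'.1.trans (hagree m).symm))
  exact congrArg Subtype.val this

end GoodActions

/-! ### The permutation of a maximal chain -/

section Permutation

variable {P : Type*} [PartialOrder P] [BoundedOrder P] {n : ℕ} {A : LocalHeckeAction P n}

/-- Two generators that are joined by a braid relation. -/
def Adjacent (i j : Fin (n - 1)) : Prop := (j : ℕ) = i + 1 ∨ (i : ℕ) = j + 1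

theorem U_comm_of_not_adjacent {i j : Fin (n - 1)} (h : ¬ Adjacent i j) (m : MaxChain P n) :
    A.U i (A.U j m) = A.U j (A.U i m) := by
  unfold Adjacent at h
  rcases lt_trichotomy (i : ℕ) j with h1 | h1 | h1
  · exact A.comm i j (by omega) m
  · rw [Fin.ext h1]
  · exact (A.comm j i (by omega) m).symm

theorem U_braid_of_adjacent {i j : Fin (n - 1)} (h : Adjacent i j) (m : MaxChain P n) :
    A.U i (A.U j (A.U i m)) = A.U j (A.U i (A.U j m)) := by
  rcases h with h | h
  · exact A.braid i j h m
  · exact (A.braid j i h m).symm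

theorem node_U_ne {i : Fin (n - 1)} {m : MaxChain P n} (h : A.U i m ≠ m) :
    (A.U i m).node (i + 1) ≠ m.node (i + 1) := by
  refine fun heq => h (SatChain.ext_node fun r => ?_)
  by_cases hr : r = i + 1
  · rw [hr, heq]
  · exact A.node_U i m hr

/-- If both `U_i` and `U_j` move `m`, for adjacent `i` and `j`, then the last step of
`m ↦ U_i m ↦ U_j U_i m ↦ U_i U_j U_i m` is nontrivial: otherwise the old and new elements of `m` at
the ranks of `i` and `j` would form a bowtie. -/
theorem U_U_U_ne (hP : BowtieFree P) {i j : Fin (n - 1)} (hij : Adjacent i j)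
    {m : MaxChain P n} (hi : A.U i m ≠ m) (hj : A.U j m ≠ m) :
    A.U i (A.U j (A.U i m)) ≠ A.U j (A.U i m) := by
  intro heq
  have hne : (i : ℕ) + 1 ≠ j + 1 := by
    unfold Adjacent at hij
    omega
  have hi2 := i.2
  have hj2 := j.2
  have h1 : (A.U i (A.U j m)).node (i + 1) = (A.U i m).node (i + 1) := by
    rw [← A.node_U j (A.U i (A.U j m)) hne, ← U_braid_of_adjacent hij, heq, A.node_U j _ hne]
  have h2 : (A.U i (A.U j m)).node (j + 1) = (A.U j m).node (j + 1) := A.node_U i _ hne.symm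
  have h3 : (A.U i m).node (j + 1) = m.node (j + 1) := A.node_U i _ hne.symm
  have h4 : (A.U j m).node (i + 1) = m.node (i + 1) := A.node_U j _ hne
  rcases hij with hij | hij
  · have hc : ∀ m : MaxChain P n, m.node (i + 1) ⋖ m.node (j + 1) := fun m => by
      rw [hij]
      exact m.node_covBy (by omega)
    have c1 := hc m
    have c2 := hc (A.U i m)
    have c3 := hc (A.U j m)
    have c4 := hc (A.U i (A.U j m))
    rw [h3] at c2
    rw [h4] at c3
    rw [h1, h2] at c4
    exact hP ⟨_, _, _, _, (node_U_ne hj).symm, (node_U_ne hi).symm, c1, c2, c3, c4⟩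
  · have hc : ∀ m : MaxChain P n, m.node (j + 1) ⋖ m.node (i + 1) := fun m => by
      rw [hij]
      exact m.node_covBy (by omega)
    have c1 := hc m
    have c2 := hc (A.U i m)
    have c3 := hc (A.U j m)
    have c4 := hc (A.U i (A.U j m))
    rw [h3] at c2
    rw [h4] at c3
    rw [h1, h2] at c4
    exact hP ⟨_, _, _, _, (node_U_ne hi).symm, (node_U_ne hj).symm, c1, c3, c2, c4⟩

theorem U_U_ne (hP : BowtieFree P) {i j : Fin (n - 1)} (hij : Adjacent i j)
    {m : MaxChain P n} (hi : A.U i m ≠ m) (hj : A.U j m ≠ m) :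
    A.U j (A.U i m) ≠ A.U i m := by
  intro heq
  refine U_U_U_ne hP hij hi hj ?_
  rw [heq, A.idem]

/-- The transposition of the positions `i` and `i + 1`. -/
def simpleSwap (i : Fin (n - 1)) : Equiv.Perm ℕ := Equiv.swap (i : ℕ) (i + 1)

theorem simpleSwap_apply (i : Fin (n - 1)) (r : ℕ) :
    simpleSwap i r = if r = i then (i : ℕ) + 1 else if r = i + 1 then (i : ℕ) else r :=
  Equiv.swap_apply_def _ _ _

theorem simpleSwap_comm {i j : Fin (n - 1)} (h : ¬ Adjacent i j) :
    simpleSwap i * simpleSwap j = simpleSwap j * simpleSwap i := by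
  unfold Adjacent at h
  refine Equiv.ext fun r => ?_
  simp only [Equiv.Perm.mul_apply, simpleSwap_apply]
  split_ifs <;> omega

theorem simpleSwap_braid {i j : Fin (n - 1)} (h : Adjacent i j) :
    simpleSwap i * simpleSwap j * simpleSwap i = simpleSwap j * simpleSwap i * simpleSwap j := by
  refine Equiv.ext fun r => ?_
  have key : ∀ i j : Fin (n - 1), Adjacent i j → (simpleSwap i * simpleSwap j * simpleSwap i) r =
      if r = max (i : ℕ) j + 1 then min (i : ℕ) j else
        if r = min (i : ℕ) j then max (i : ℕ) j + 1 else r := by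
    intro i j h
    simp only [Equiv.Perm.mul_apply, simpleSwap_apply]
    rcases h with h | h <;> rw [h] <;> split_ifs <;> omega
  rw [key i j h, key j i h.symm, max_comm, min_comm]

/-- `IsSortingPerm A m w` means that `w` is the product of the simple transpositions along a path
of nontrivial steps `m ↦ U_i m` from `m` to a chain that is fixed by all `U_i`. -/
inductive IsSortingPerm (A : LocalHeckeAction P n) : MaxChain P n → Equiv.Perm ℕ → Prop
  | base (m : MaxChain P n) (h : ∀ i, A.U i m = m) : IsSortingPerm A m 1
  | step (m : MaxChain P n) (i : Fin (n - 1)) (w : Equiv.Perm ℕ) (h : A.U i m ≠ m)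
      (hw : IsSortingPerm A (A.U i m) w) : IsSortingPerm A m (w * simpleSwap i)

theorem IsTriangular.wellFounded [Finite P] (hA : A.IsTriangular) :
    WellFounded fun m' m : MaxChain P n => m' ≠ m ∧ ∃ u, A.act u m = m' := by
  have : IsTrans (MaxChain P n) fun m' m => m' ≠ m ∧ ∃ u, A.act u m = m' := by
    refine ⟨?_⟩
    rintro m₃ m₂ m₁ ⟨h1, v, rfl⟩ ⟨h2, u, rfl⟩
    refine ⟨fun heq => h2 (A.act_eq_self fun i hi => ?_), v ++ u, A.act_append v u m₁⟩
    rw [← act_append] at heq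
    exact hA _ _ heq i (by simp [hi])
  have : Std.Irrefl fun m' m : MaxChain P n => m' ≠ m ∧ ∃ u, A.act u m = m' :=
    ⟨fun m h => h.1 rfl⟩
  exact Finite.wellFounded_of_trans_of_irrefl _

theorem IsTriangular.exists_isSortingPerm [Finite P] (hA : A.IsTriangular) (m : MaxChain P n) :
    ∃ w, IsSortingPerm A m w := by
  induction m using hA.wellFounded.induction with
  | _ m ih =>
    by_cases h : ∀ i, A.U i m = m
    · exact ⟨1, .base m h⟩
    · obtain ⟨i, hi⟩ := not_forall.1 h
      obtain ⟨w, hw⟩ := ih (A.U i m) ⟨hi, [i], rfl⟩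
      exact ⟨_, .step m i w hi hw⟩

/-- The paths from `m` to a fixed chain all give the same permutation: two first steps `U_i` and
`U_j` can be completed to a square or, in the absence of bowties, to a nondegenerate hexagon. -/
theorem IsTriangular.isSortingPerm_unique [Finite P] (hA : A.IsTriangular) (hP : BowtieFree P)
    {m : MaxChain P n} {w w' : Equiv.Perm ℕ} (h : IsSortingPerm A m w)
    (h' : IsSortingPerm A m w') : w = w' := by
  induction m using hA.wellFounded.induction generalizing w w' with
  | _ m ih =>
    rcases h with ⟨_, h⟩ | ⟨_, i, w, hi, hw⟩
    · rcases h' with _ | ⟨_, j, w', hj, hw'⟩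
      · rfl
      · exact absurd (h j) hj
    · rcases h' with ⟨_, h⟩ | ⟨_, j, w', hj, hw'⟩
      · exact absurd (h i) hi
      · by_cases hij : i = j
        · subst hij
          rw [ih _ ⟨hi, [i], rfl⟩ hw hw']
        by_cases hadj : Adjacent i j
        · obtain ⟨v, hv⟩ := hA.exists_isSortingPerm (A.U i (A.U j (A.U i m)))
          have hv' := hv
          rw [U_braid_of_adjacent hadj] at hv'
          have h1 := IsSortingPerm.step _ _ _ (U_U_ne hP hadj hi hj)
            (.step _ _ _ (U_U_U_ne hP hadj hi hj) hv)
          have h2 := IsSortingPerm.step _ _ _ (U_U_ne hP hadj.symm hj hi)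
            (.step _ _ _ (U_U_U_ne hP hadj.symm hj hi) hv')
          rw [ih _ ⟨hi, [i], rfl⟩ hw h1, ih _ ⟨hj, [j], rfl⟩ hw' h2]
          simp only [mul_assoc]
          rw [← mul_assoc (simpleSwap i), ← mul_assoc (simpleSwap j), simpleSwap_braid hadj]
        · have hne : ∀ i j : Fin (n - 1), i ≠ j → ¬ Adjacent i j → A.U j m ≠ m →
              A.U j (A.U i m) ≠ A.U i m := by
            intro i j hij hadj hj heq
            refine node_U_ne hj ?_
            have hne : (j : ℕ) + 1 ≠ i + 1 := fun h => hij (Fin.ext (by omega))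
            rw [← A.node_U i (A.U j m) hne, U_comm_of_not_adjacent hadj, heq, A.node_U i m hne]
          obtain ⟨v, hv⟩ := hA.exists_isSortingPerm (A.U j (A.U i m))
          have hv' := hv
          rw [← U_comm_of_not_adjacent hadj] at hv'
          have h1 := IsSortingPerm.step _ _ _ (hne i j hij hadj hj) hv
          have h2 := IsSortingPerm.step _ _ _
            (hne j i (Ne.symm hij) (fun h => hadj h.symm) hi) hv'
          rw [ih _ ⟨hi, [i], rfl⟩ hw h1, ih _ ⟨hj, [j], rfl⟩ hw' h2, mul_assoc, mul_assoc,
            simpleSwap_comm hadj]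

/-- The permutation of a maximal chain under a triangular action. -/
noncomputable def IsTriangular.perm [Finite P] (hA : A.IsTriangular) (m : MaxChain P n) :
    Equiv.Perm ℕ :=
  (hA.exists_isSortingPerm m).choose

theorem IsTriangular.isSortingPerm_perm [Finite P] (hA : A.IsTriangular) (m : MaxChain P n) :
    IsSortingPerm A m (hA.perm m) :=
  (hA.exists_isSortingPerm m).choose_spec

theorem IsTriangular.perm_of_ne [Finite P] (hA : A.IsTriangular) (hP : BowtieFree P)
    {i : Fin (n - 1)} {m : MaxChain P n} (h : A.U i m ≠ m) :
    hA.perm m = hA.perm (A.U i m) * simpleSwap i :=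
  hA.isSortingPerm_unique hP (hA.isSortingPerm_perm m) (.step _ _ _ h (hA.isSortingPerm_perm _))

theorem IsSortingPerm.apply_of_ge {m : MaxChain P n} {w : Equiv.Perm ℕ}
    (h : IsSortingPerm A m w) {r : ℕ} (hr : n ≤ r) : w r = r := by
  induction h with
  | base m h => rfl
  | step m i w h hw ih =>
    have := i.2
    rw [Equiv.Perm.mul_apply, simpleSwap_apply, if_neg (by omega), if_neg (by omega), ih]

theorem IsTriangular.perm_lt [Finite P] (hA : A.IsTriangular) (m : MaxChain P n) {r : ℕ}
    (hr : r < n) : hA.perm m r < n := by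
  by_contra h
  have := (hA.perm m).injective ((hA.isSortingPerm_perm m).apply_of_ge (not_lt.1 h))
  omega

theorem IsTriangular.perm_lt_of_fixed [Finite P] (hA : A.IsTriangular) (hP : BowtieFree P)
    {i : Fin (n - 1)} {m : MaxChain P n} (h : A.U i m = m) :
    hA.perm m i < hA.perm m (i + 1) := by
  induction m using hA.wellFounded.induction generalizing i with
  | _ m ih =>
    by_cases hall : ∀ j, A.U j m = m
    · rw [hA.isSortingPerm_unique hP (hA.isSortingPerm_perm m) (.base m hall)]
      exact Nat.lt_succ_self _
    obtain ⟨j, hj⟩ := not_forall.1 hall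
    have hij : i ≠ j := by
      rintro rfl
      exact hj h
    have hij' : (i : ℕ) ≠ j := fun h => hij (Fin.ext h)
    by_cases hadj : Adjacent i j
    · -- The chain `b` below `m` and `U_j m` is fixed by `U_i` and `U_j`, so its permutation
      -- increases at the three positions concerned, and it is one or two steps away from `m`.
      set b := A.U i (A.U j m) with hb
      have hbi : A.U i b = b := A.idem i _
      have hbj : A.U j b = b := by
        rw [hb, ← U_braid_of_adjacent hadj, h]
      have hbm : b ≠ m := fun hbm => hj (hA [i, j] m hbm j (by simp))
      have h1 := ih b ⟨hbm, [i, j], rfl⟩ hbi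
      have h2 := ih b ⟨hbm, [i, j], rfl⟩ hbj
      have hm := hA.perm_of_ne hP hj
      by_cases hbe : b = A.U j m
      · rw [hm, ← hbe]
        simp only [Equiv.Perm.mul_apply, simpleSwap_apply]
        rcases hadj with hadj | hadj
        · simp only [hadj] at h2 ⊢
          simp [show (i : ℕ) ≠ i + 1 + 1 by omega]
          omega
        · simp only [hadj] at h1 ⊢
          simp [show (j : ℕ) + 1 + 1 ≠ j by omega]
          omega
      · rw [hm, hA.perm_of_ne hP (i := i) (m := A.U j m) hbe, ← hb]
        simp only [Equiv.Perm.mul_apply, simpleSwap_apply]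
        rcases hadj with hadj | hadj
        · simp only [hadj] at h2 ⊢
          simp [show (i : ℕ) ≠ i + 1 + 1 by omega, show (i : ℕ) + 1 + 1 ≠ i by omega]
          omega
        · simp only [hadj] at h1 ⊢
          simp [show (j : ℕ) ≠ j + 1 + 1 by omega, show (j : ℕ) + 1 + 1 ≠ j by omega]
          omega
    · have hfix : A.U i (A.U j m) = A.U j m := by
        rw [U_comm_of_not_adjacent hadj, h]
      have h1 := ih (A.U j m) ⟨hj, [j], rfl⟩ hfix
      unfold Adjacent at hadj
      rw [hA.perm_of_ne hP hj]
      simp only [Equiv.Perm.mul_apply, simpleSwap_apply]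
      rw [if_neg (by omega), if_neg (by omega), if_neg (by omega), if_neg (by omega)]
      exact h1

theorem IsTriangular.perm_lt_iff [Finite P] (hA : A.IsTriangular) (hP : BowtieFree P)
    {i : Fin (n - 1)} {m : MaxChain P n} :
    hA.perm m i < hA.perm m (i + 1) ↔ A.U i m = m := by
  refine ⟨fun h => ?_, hA.perm_lt_of_fixed hP⟩
  by_contra hne
  have h1 := hA.perm_lt_of_fixed hP (A.idem i m)
  rw [hA.perm_of_ne hP hne] at h
  simp only [Equiv.Perm.mul_apply, simpleSwap_apply, if_true] at h
  rw [if_neg (by omega)] at h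
  omega

theorem IsTriangular.perm_act_apply [Finite P] (hA : A.IsTriangular) (hP : BowtieFree P)
    {u : List (Fin (n - 1))} {r : ℕ} (hu : ∀ j ∈ u, r ≠ j ∧ r ≠ j + 1) (m : MaxChain P n) :
    hA.perm (A.act u m) r = hA.perm m r := by
  induction u with
  | nil => rfl
  | cons j u ih =>
    rw [← ih fun i hi => hu i (by simp [hi]), act_cons]
    by_cases h : A.U j (A.act u m) = A.act u m
    · rw [h]
    · obtain ⟨h1, h2⟩ := hu j (by simp)
      rw [hA.perm_of_ne hP h, Equiv.Perm.mul_apply, simpleSwap_apply, if_neg h1, if_neg h2]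

/-- The value of the permutation of a maximal chain at `r` depends only on the step of the chain
from rank `r` to rank `r + 1`: below and above that step, any two chains can be sorted to the same
chain without affecting the value. -/
theorem IsTriangular.perm_apply_eq [Finite P] (hA : A.IsTriangular) (hU : A.HasUniqueFixed)
    (hP : BowtieFree P) {m m' : MaxChain P n} {r : ℕ} (h1 : m.node r = m'.node r)
    (h2 : m.node (r + 1) = m'.node (r + 1)) : hA.perm m r = hA.perm m' r := by
  classical
  let J : Finset (Fin (n - 1)) := Finset.univ.filter fun j => r ≠ j ∧ r ≠ j + 1
  have hJ : ∀ j, j ∈ J ↔ r ≠ j ∧ r ≠ j + 1 := fun j => by simp [J]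
  obtain ⟨u, hu1, hu2⟩ := A.exists_absorbing_word J
  have hu : ∀ j ∈ u, j ∈ J := fun j hj => (hu1 j).1 hj
  have hmm : AgreeOff J m m' := by
    intro q hq
    by_cases hq1 : q = r
    · rw [hq1, h1]
    by_cases hq2 : q = r + 1
    · rw [hq2, h2]
    rcases Nat.eq_zero_or_pos q with rfl | hq0
    · rw [m.node_zero, m'.node_zero]
    rcases le_or_gt n q with hqn | hqn
    · rw [m.node_of_ge hqn, m'.node_of_ge hqn]
    · refine absurd ?_ (hq ⟨q - 1, by omega⟩ ((hJ _).2 ?_))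
      · simp only
        omega
      · simp only
        omega
  have heq : A.act u m = A.act u m' :=
    (hU J m').unique ⟨(A.agreeOff_act hu m).trans hmm, fun j hj => hu2 j hj m⟩
      ⟨A.agreeOff_act hu m', fun j hj => hu2 j hj m'⟩
  rw [← hA.perm_act_apply hP (fun j hj => (hJ j).1 (hu j hj)) m, heq,
    hA.perm_act_apply hP fun j hj => (hJ j).1 (hu j hj)]

end Permutation

/-! ### The labeling defined by a good action -/

section Backward

variable {P : Type*} [PartialOrder P] [Finite P] [BoundedOrder P] [GradeMinOrder ℕ P] {n : ℕ}
  {A : LocalHeckeAction P n}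

/-- The label of an edge from rank `r` to rank `r + 1`: the value at `r`, plus one, of the
permutation of some maximal chain through that edge. -/
noncomputable def IsTriangular.label (hA : A.IsTriangular) (hn : grade ℕ (⊤ : P) = n)
    (e : Edge P) : ℤ :=
  hA.perm (exists_maxChain_through_pair hn e.2.le).choose (grade ℕ e.1.1) + 1

theorem IsTriangular.stepLabel_label (hA : A.IsTriangular) (hU : A.HasUniqueFixed)
    (hP : BowtieFree P) (hn : grade ℕ (⊤ : P) = n) (m : MaxChain P n) {r : ℕ} (hr : r < n) :
    stepLabel (hA.label hn) m r = hA.perm m r + 1 := by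
  have hc := m.node_covBy hr
  have hg := grade_node_max m hr.le
  have hg' := grade_node_max m (Nat.succ_le_of_lt hr)
  obtain ⟨h1, h2⟩ := (exists_maxChain_through_pair hn hc.le).choose_spec
  rw [stepLabel, edgeLabel, dif_pos hc, label]
  simp only
  generalize (exists_maxChain_through_pair hn hc.le).choose = m₁ at h1 h2 ⊢
  rw [hg] at h1 ⊢
  rw [hg'] at h2
  rw [hA.perm_apply_eq hU hP h1 h2]

/-- A weakly increasing sequence lexicographically precedes every other sequence with the same
values: at the first difference, a smaller value of the other sequence would have occurred
before. -/
theorem toLex_lt_of_monotone {k : ℕ} {f g : Fin k → ℤ} (hf : Monotone f)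
    (hg : Function.Injective g) (hfg : ∀ i, ∃ j, f j = g i) (hne : f ≠ g) :
    toLex f < toLex g := by
  obtain ⟨i, hi, hmin⟩ := WellFounded.has_min (wellFounded_lt (α := Fin k)) {i | f i ≠ g i}
    (Function.ne_iff.1 hne)
  have heq : ∀ j < i, f j = g j := fun j hj => by
    by_contra h
    exact hmin j h hj
  refine ⟨i, heq, ?_⟩
  change f i < g i
  obtain ⟨j, hj⟩ := hfg i
  rcases lt_or_ge j i with h | h
  · rw [heq j h] at hj
    exact absurd (hg hj) h.ne
  · exact lt_of_le_of_ne (hj ▸ hf h) hi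

theorem IsTriangular.isELLabeling_label (hA : A.IsTriangular) (hU : A.HasUniqueFixed)
    (hP : BowtieFree P) (hn : grade ℕ (⊤ : P) = n) : IsELLabeling (hA.label hn) := by
  classical
  intro s t hst
  set a := grade ℕ s with ha
  have hab : a ≤ grade ℕ t := grade_mono hst
  obtain ⟨l, hl⟩ := Nat.exists_eq_add_of_le hab
  have hbn : a + l ≤ n := by
    rw [← hl, ← hn]
    exact grade_mono le_top
  rw [hl, Nat.add_sub_cancel_left]
  let J : Finset (Fin (n - 1)) := Finset.univ.filter fun j => a < j + 1 ∧ (j : ℕ) + 1 < a + l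
  have hJ : ∀ j, j ∈ J ↔ a < j + 1 ∧ (j : ℕ) + 1 < a + l := fun j => by simp [J]
  have hJ' : ∀ r, r ≤ a ∨ a + l ≤ r → ∀ j ∈ J, r ≠ j + 1 := fun r hr j hj => by
    have := (hJ j).1 hj
    omega
  obtain ⟨m₀, hs₀, ht₀⟩ := exists_maxChain_through_pair hn hst
  obtain ⟨M, ⟨hM, hMfix⟩, -⟩ := hU J m₀
  have hs : M.node a = s := (hM a (hJ' a (by omega))).trans hs₀
  have ht : M.node (a + l) = t := by
    rw [hM (a + l) (hJ' _ (by omega)), ← hl, ht₀]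
  -- The labels of a chain of `[s, t]` are values of the permutation of an extension.
  have hlab : ∀ (d : MaxChain P n) (c : SatChain s t l), (∀ r ≤ l, d.node (a + r) = c.node r) →
      ∀ r, r < l → stepLabel (hA.label hn) c r = hA.perm d (a + r) + 1 := by
    intro d c hdc r hr
    rw [← hA.stepLabel_label hU hP hn d (by omega), stepLabel, stepLabel, ← hdc r hr.le,
      ← hdc (r + 1) hr, Nat.add_assoc]
  have hmono : ∀ (d : MaxChain P n) (c : SatChain s t l),
      (∀ r ≤ l, d.node (a + r) = c.node r) →
      (Monotone (c.labels (hA.label hn)) ↔ ∀ j ∈ J, A.U j d = d) := by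
    intro d c hdc
    rw [labels_monotone_iff]
    constructor
    · intro h j hj
      obtain ⟨h1, h2⟩ := (hJ j).1 hj
      obtain ⟨r, hr⟩ := Nat.exists_eq_add_of_le (Nat.le_of_lt_succ h1)
      have h3 := h r (by omega)
      rw [hlab d c hdc r (by omega), hlab d c hdc (r + 1) (by omega), ← Nat.add_assoc, ← hr] at h3
      rw [← hA.perm_lt_iff hP]
      refine lt_of_le_of_ne (by omega) fun heq => ?_
      have := (hA.perm d).injective heq
      omega
    · intro h r hr
      have h3 := (hA.perm_lt_iff hP).2 (h ⟨a + r, by omega⟩ ((hJ _).2 ⟨by simp only; omega, by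
        simp only; omega⟩))
      simp only at h3
      rw [hlab d c hdc r (by omega), hlab d c hdc (r + 1) (by omega), ← Nat.add_assoc]
      omega
  obtain ⟨c, hc⟩ := M.exists_restrict hbn hs ht
  have hcm := (hmono M c fun r hr => (hc r hr).symm).2 hMfix
  refine ⟨c, hcm, fun c' hne => ?_⟩
  obtain ⟨M', h1, h2⟩ := M.exists_splice c' hbn hs ht
  have hagree : AgreeOff J M' M := fun r hr => by
    by_cases hra : r ≤ a ∨ a + l ≤ r
    · exact h1 r hra
    · refine absurd ?_ (hr ⟨r - 1, by omega⟩ ((hJ _).2 ?_)) <;> simp only <;> omega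
  have hnm : ¬ Monotone (c'.labels (hA.label hn)) := by
    intro hm
    have hM' := (hmono M' c' h2).1 hm
    have heq : M' = M := (hU J M).unique ⟨hagree, hM'⟩ ⟨fun _ _ => rfl, hMfix⟩
    refine hne (SatChain.ext_node fun r => ?_)
    rcases le_or_gt r l with hr | hr
    · rw [← h2 r hr, hc r hr, heq]
    · rw [c.node_of_ge hr.le, c'.node_of_ge hr.le]
  refine ⟨hnm, toLex_lt_of_monotone hcm ?_ ?_ ?_⟩
  · intro i j hij
    rw [labels_apply, labels_apply, hlab M' c' h2 i i.2, hlab M' c' h2 j j.2] at hij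
    have := (hA.perm M').injective (show hA.perm M' (a + i) = hA.perm M' (a + j) by omega)
    exact Fin.ext (by omega)
  · -- Outside `[s, t]` the two permutations agree, so inside they have the same values.
    intro i
    set q := (hA.perm M).symm (hA.perm M' (a + i)) with hq
    have hq' : hA.perm M q = hA.perm M' (a + i) := Equiv.apply_symm_apply _ _
    have hin : a ≤ q ∧ q < a + l := by
      by_contra hout
      have h3 : hA.perm M' q = hA.perm M q :=
        hA.perm_apply_eq hU hP (h1 q (by omega)) (h1 (q + 1) (by omega))
      have := (hA.perm M').injective (h3.trans hq')
      omega
    obtain ⟨r, hr⟩ := Nat.exists_eq_add_of_le hin.1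
    refine ⟨⟨r, by omega⟩, ?_⟩
    rw [labels_apply, labels_apply, hlab M' c' h2 i i.2,
      hlab M c (fun r hr => (hc r hr).symm) r (by omega), ← hr, hq']
  · intro heq
    exact hnm (heq ▸ hcm)

theorem IsTriangular.isSnELLabeling_label (hA : A.IsTriangular) (hU : A.HasUniqueFixed)
    (hP : BowtieFree P) (hn : grade ℕ (⊤ : P) = n) : IsSnELLabeling n (hA.label hn) := by
  refine ⟨hA.isELLabeling_label hU hP hn, fun m => ?_⟩
  have hinj : Function.Injective fun i : Fin n =>
      (⟨hA.perm m i, hA.perm_lt m i.2⟩ : Fin n) := by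
    intro i j hij
    exact Fin.ext ((hA.perm m).injective (Fin.mk.inj hij))
  refine ⟨Equiv.ofBijective _ (Finite.injective_iff_bijective.1 hinj), fun i => ?_⟩
  rw [labels_apply, hA.stepLabel_label hU hP hn m i.2, Equiv.ofBijective_apply]

end Backward

end LocalHeckeAction

end GradedPoset

theorem mainTheorem3 {P : Type*} [PartialOrder P] [Finite P] [BoundedOrder P] [GradeMinOrder ℕ P]
    (n : ℕ) (hn : grade ℕ (⊤ : P) = n) (hP : GradedPoset.BowtieFree P) :
    GradedPoset.IsSnELShellable P n ↔ GradedPoset.HasGoodHeckeAction P n := by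
  refine ⟨fun h => h.hasGoodHeckeAction hn, ?_⟩
  rintro ⟨A, hA⟩
  exact ⟨_, hA.isTriangular.isSnELLabeling_label (hA.hasUniqueFixed hn) hP hn⟩
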